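/- Conventions. Let $U\subset\mathbb C$ be a domain and $F:U\to\mathbb R^3$ a smooth conformal immersion, with metric $e^u\,dz\,d\bar z$, unit normal $N$ such that $(F_x,F_y,N)$ is positively oriented, mean curvature $H$ given by $\langle F_{z\bar z},N\rangle=\tfrac12He^u$, and Hopf differential $Q\,dz^2$, $Q=\langle F_{zz},N\rangle$. The surface is a *Bonnet surface* if $H$ is not constant and there is a smooth family $F_\tau$, $\tau\in(-\epsilon,\epsilon)$, $F_0=F$ (a *Bonnet family*), of conformal immersions of $U$ with the same metric and the same mean curvature function, no two of which differ by an isometry of $\mathbb R^3$. It is *of type $\mathbf B_{\mathcal V}$* if moreover $H$ has an isolated critical point. A critical point $p$ of $H$ has *index* $-J$, $J\ge 0$ an integer, if for some Bonnet family with Hopf differentials $Q(z,\tau)\,dz^2$ one has, near $p$, $$\partial_\tau Q=(z-p)^J\varphi(z,\tau),\qquad Q=-i\,(z-p)^J\,\frac{\varphi(z,\tau)}{\psi(z,\tau)},\qquad \partial_z\psi=(z-p)^{J+1}\theta(z,\tau),$$ where $\varphi,\theta$ are holomorphic in $z$, $\varphi$ has no zeros, $\theta(p,\tau)\neq0$,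 and $\psi$ is real-valued, harmonic in $z$ and has no zeros. **Theorem.** For every integer $J\ge0$, every $H(0)\in\mathbb R$ and every $H_0<0$ there is a real-analytic Bonnet surface of type $\mathbf B_{\mathcal V}$, conformally parametrized by a disc $\{|w|<r\}$, $0<r\le1$, for which $w=0$ is an isolated critical point of the mean curvature, of index $-J$, and at which the mean curvature and the metric are $$H(0)\qquad\text{and}\qquad -2\,\frac{(J+2)^2}{(J+1)\,H_0}\,dw\,d\bar w .$$ Here $w$ is the normalized coordinate at the critical point: with $s=|w|^2$, the mean curvature is a function $H(s)=H(0)+s^{J+1}B(s)$, where $B$ is real-analytic and nowhere zero on $[0,r^2)$ and $B(0)=H_0$; this function solves $$\left(\frac{sH''}{H'}\right)'-H'=\frac{(J+2)^2s^{J+1}}{(1-s^{J+2})^2}\left(2-\frac{H^2}{sH'}\right)\qquad(0<s<r^2);$$ and $$Q=(J+2)\,\frac{1-\bar w^{J+2}}{1-w^{J+2}}\cdot\frac{w^J}{1-s^{J+2}},\qquad e^{u}=-2(J+2)^2\frac{s^J}{(1-s^{J+2})^2H'(s)}\quad(w\ne0).$$ -/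

import Mathlib

open scoped ContDiff Topology

noncomputable section

namespace BonnetSurface

/-- Euclidean 3-space. -/
abbrev E3 : Type := EuclideanSpace ℝ (Fin 3)

/-- The partial derivative `∂f/∂x` with respect to `x = Re z`. -/
def dx {E : Type*} [NormedAddCommGroup E] [NormedSpace ℝ E] (f : ℂ → E) (z : ℂ) : E :=
  fderiv ℝ f z 1

/-- The partial derivative `∂f/∂y` with respect to `y = Im z`. -/
def dy {E : Type*} [NormedAddCommGroup E] [NormedSpace ℝ E] (f : ℂ → E) (z : ℂ) : E :=
  fderiv ℝ f z Complex.I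

/-- The Wirtinger derivative `∂g/∂z = (∂g/∂x - i ∂g/∂y) / 2`. -/
def dz (g : ℂ → ℂ) (z : ℂ) : ℂ :=
  (dx g z - Complex.I * dy g z) / 2

/-- The cross product of Euclidean 3-space. -/
def cross (a b : E3) : E3 :=
  WithLp.toLp 2 (crossProduct (WithLp.ofLp a) (WithLp.ofLp b))

/-- The unit normal `N`, for which `(F_x, F_y, N)` is positively oriented. -/
def unitNormal (f : ℂ → E3) (z : ℂ) : E3 :=
  ‖cross (dx f z) (dy f z)‖⁻¹ • cross (dx f z) (dy f z)

/-- The coefficient `e^u = 2 ⟨F_z, F_z̄⟩ = (|F_x|² + |F_y|²) / 2` of the metric `e^u dz dz̄` of a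
conformally parametrized surface. -/
def metricCoeff (f : ℂ → E3) (z : ℂ) : ℝ :=
  (‖dx f z‖ ^ 2 + ‖dy f z‖ ^ 2) / 2

/-- The mean curvature `H` of a conformally parametrized surface:
`⟨F_{z z̄}, N⟩ = H e^u / 2`, where `F_{z z̄} = (F_xx + F_yy) / 4`. -/
def meanCurvature (f : ℂ → E3) (z : ℂ) : ℝ :=
  inner ℝ (dx (dx f) z + dy (dy f) z) (unitNormal f z) / (2 * metricCoeff f z)

/-- The coefficient `Q = ⟨F_zz, N⟩` of the Hopf differential `Q dz²`, where
`F_zz = (F_xx - F_yy - 2 i F_xy) / 4`. -/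
def hopf (f : ℂ → E3) (z : ℂ) : ℂ :=
  ((inner ℝ (dx (dx f) z - dy (dy f) z) (unitNormal f z) : ℝ)
    - 2 * Complex.I * (inner ℝ (dx (dy f) z) (unitNormal f z) : ℝ)) / 4

/-- `f` is a conformal immersion on `U`: its differential exists and is nonzero at every point, and
`⟨F_z, F_z⟩ = 0`, that is, `|F_x| = |F_y|` and `F_x ⟂ F_y`. -/
def IsConformalImmersion (U : Set ℂ) (f : ℂ → E3) : Prop :=
  ∀ z ∈ U, DifferentiableAt ℝ f z ∧ dx f z ≠ 0 ∧ ‖dx f z‖ = ‖dy f z‖ ∧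
    inner ℝ (dx f z) (dy f z) = 0

/-- `F τ`, `-ε < τ < ε`, is a Bonnet family over the domain `U`: a smooth one-parameter family of
conformal immersions with the same metric and the same non-constant mean curvature function, no two
of which differ by an isometry of the ambient space. -/
structure IsBonnetFamily (U : Set ℂ) (ε : ℝ) (F : ℝ → ℂ → E3) : Prop where
  isOpen : IsOpen U
  isConnected : IsConnected U
  pos : 0 < ε
  smooth : ContDiffOn ℝ ∞ (fun p : ℝ × ℂ => F p.1 p.2) (Set.Ioo (-ε) ε ×ˢ U)
  conformal : ∀ τ ∈ Set.Ioo (-ε) ε, IsConformalImmersion U (F τ)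
  isometric : ∀ τ ∈ Set.Ioo (-ε) ε, ∀ z ∈ U, metricCoeff (F τ) z = metricCoeff (F 0) z
  meanCurvature_eq : ∀ τ ∈ Set.Ioo (-ε) ε, ∀ z ∈ U,
    meanCurvature (F τ) z = meanCurvature (F 0) z
  nonconstant : ∃ z ∈ U, ∃ z' ∈ U, meanCurvature (F 0) z ≠ meanCurvature (F 0) z'
  nontrivial : ∀ τ ∈ Set.Ioo (-ε) ε, ∀ τ' ∈ Set.Ioo (-ε) ε, τ ≠ τ' →
    ¬ ∃ g : E3 ≃ᵢ E3, ∀ z ∈ U, F τ' z = g (F τ z)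

/-- The surface `f`, conformally parametrized by the domain `U`, is a Bonnet surface. -/
def IsBonnetSurface (U : Set ℂ) (f : ℂ → E3) : Prop :=
  ∃ (ε : ℝ) (F : ℝ → ℂ → E3), IsBonnetFamily U ε F ∧ Set.EqOn (F 0) f U

/-- The set of critical points (`dH = 0`) of the mean curvature function. -/
def criticalSet (U : Set ℂ) (f : ℂ → E3) : Set ℂ :=
  {z ∈ U | fderiv ℝ (meanCurvature f) z = 0}

/-- `p` is an isolated critical point of the mean curvature function. -/
def IsIsolatedCriticalPoint (U : Set ℂ) (f : ℂ → E3) (p : ℂ) : Prop :=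
  p ∈ criticalSet U f ∧ ∀ᶠ z in 𝓝[≠] p, z ∉ criticalSet U f

/-- A Bonnet surface of type `B_𝒱`: a Bonnet surface with an isolated critical point of the mean
curvature function. -/
def IsTypeBV (U : Set ℂ) (f : ℂ → E3) : Prop :=
  IsBonnetSurface U f ∧ ∃ p, IsIsolatedCriticalPoint U f p

/-- `p` is a critical point of index `k = -J` of the Bonnet surface `f`: for some Bonnet family
`F τ` of `f`, with Hopf differentials `Q(z, τ) dz²`, one has near `p`
* `∂Q/∂τ = (z - p)^J φ(z, τ)` with `φ` holomorphic in `z` and nowhere zero;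
* `Q = -i (z - p)^J φ / ψ` with `ψ` (the `τ`-derivative of the argument of `Q`) real-valued,
  harmonic in `z` and nowhere zero;
* `∂ψ/∂z = (z - p)^(J+1) θ(z, τ)` with `θ` holomorphic in `z` and `θ(p, τ) ≠ 0`.

These orders do not depend on the conformal chart, so the chart `z - p` centred at `p` is used. -/
def HasCriticalPointOfIndex (U : Set ℂ) (f : ℂ → E3) (p : ℂ) (k : ℤ) : Prop :=
  p ∈ criticalSet U f ∧
  ∃ (ε : ℝ) (F : ℝ → ℂ → E3), IsBonnetFamily U ε F ∧ Set.EqOn (F 0) f U ∧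
  ∃ J : ℕ, k = -(J : ℤ) ∧
  ∃ W : Set ℂ, IsOpen W ∧ p ∈ W ∧ W ⊆ U ∧
  ∃ (φ θ : ℝ → ℂ → ℂ) (ψ : ℝ → ℂ → ℝ), ∀ τ ∈ Set.Ioo (-ε) ε,
    DifferentiableOn ℂ (φ τ) W ∧ DifferentiableOn ℂ (θ τ) W ∧
    InnerProductSpace.HarmonicOnNhd (ψ τ) W ∧ θ τ p ≠ 0 ∧
    ∀ z ∈ W, φ τ z ≠ 0 ∧ ψ τ z ≠ 0 ∧
      HasDerivAt (fun t : ℝ => hopf (F t) z) ((z - p) ^ J * φ τ z) τ ∧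
      hopf (F τ) z = -Complex.I * (z - p) ^ J * (φ τ z / (ψ τ z : ℂ)) ∧
      dz (fun ζ => (ψ τ ζ : ℂ)) z = (z - p) ^ (J + 1) * θ τ z

/-- The coordinate `w` of the disc `|w| < r ≤ 1` is the normalized conformal coordinate of the
surface `f` at the critical point `w = 0` of index `-J`: with `s = |w|²`, the mean curvature is
`h(s) = h(0) + s^(J+1) B(s)` for a real-analytic nowhere vanishing `B`, the Hopf differential and
the metric have the canonical form, and `h` solves the Hazzidakis equation.
At `w = 0` the formula for the metric is read as a limit, hence the condition `w ≠ 0`. -/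
structure IsNormalCoordinate (J : ℕ) (r : ℝ) (f : ℂ → E3) (h B : ℝ → ℝ) : Prop where
  pos : 0 < r
  le_one : r ≤ 1
  analytic : AnalyticOnNhd ℝ B (Set.Ico 0 (r ^ 2))
  nonvanishing : ∀ s ∈ Set.Ico 0 (r ^ 2), B s ≠ 0
  expansion : ∀ s : ℝ, h s = h 0 + s ^ (J + 1) * B s
  hazzidakis : ∀ s ∈ Set.Ioo 0 (r ^ 2),
    deriv (fun x => x * deriv (deriv h) x / deriv h x) s - deriv h s =
      ((J : ℝ) + 2) ^ 2 * s ^ (J + 1) / (1 - s ^ (J + 2)) ^ 2 *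
        (2 - h s ^ 2 / (s * deriv h s))
  meanCurvature_eq : ∀ w ∈ Metric.ball (0 : ℂ) r, meanCurvature f w = h (‖w‖ ^ 2)
  hopf_eq : ∀ w ∈ Metric.ball (0 : ℂ) r,
    hopf f w = ((J : ℂ) + 2) * ((1 - (starRingEnd ℂ w) ^ (J + 2)) / (1 - w ^ (J + 2))) *
      (w ^ J / (1 - ((‖w‖ ^ 2 : ℝ) : ℂ) ^ (J + 2)))
  metric_eq : ∀ w ∈ Metric.ball (0 : ℂ) r, w ≠ 0 →
    metricCoeff f w = -2 * ((J : ℝ) + 2) ^ 2 *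
      ((‖w‖ ^ 2) ^ J / ((1 - (‖w‖ ^ 2) ^ (J + 2)) ^ 2 * deriv h (‖w‖ ^ 2)))

end BonnetSurface

end

/-! Everything is built from radial data. Write `n = J + 2`, `s = |w|²`, `G₀ = (J + 1) H₀` and `h' =
s ^ J G` with `G = G₀ exp g`. Then `s h'' / h' = J + s g'`, so the Hazzidakis equation becomes `(s
g')' = s ^ J G + n² (1 - s ^ n)⁻² (2 s ^ (J + 1) - h² / G)`, whose right-hand side is regular at `s
= 0`. Integrating twice from `0` gives a fixed-point equation `y = s • Φ (s, y)` for the ray `y(t) =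
g (t s)` in `C([0,1])`, and the analytic implicit function theorem solves it
(`exists_analyticAt_hazzidakis`).

With the prescribed `Q`, the Codazzi equation forces the stated metric, which is positive because
`G₀ < 0`, and the Gauss equation is then the Hazzidakis equation. Bonnet's theorem
(`exists_analyticAt_of_gauss_codazzi`) gives the surface `f` near `0`. It rests on an analytic
Frobenius theorem (`exists_analyticAt_parallel`), again proved by solving a Volterra equation along
rays.

The Bonnet family is `f (exp (iτ) w)`. Metric and mean curvature are radial, hence unchanged, while
`Q` becomes `hopfQ J μ` with `μ = exp (i n τ)` (`hopfQ_mul`). An ambient isometry changes `H` and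
`Q` by a common sign (`curvature_of_isometry`). That sign is `+` where `H ≠ 0`, and `hopfQ J μ w`
determines `μ` for `w ≠ 0`, so distinct members are not congruent. The index is read off from the
explicit `∂Q/∂τ` and from `ψ`, the real part of the Herglotz kernel (`hopfQ_eq_div_herglotz`). -/

noncomputable section

namespace BonnetSurface

open unitInterval Set Filter

/-! ### Averages and restrictions to rays in `C([0,1])` -/

section Rays

variable {V : Type*} [NormedAddCommGroup V] [NormedSpace ℝ V]

/-- The averages `t ↦ ∫₀¹ f (t x) dx` of a continuous function on the unit interval. -/
def avg (V : Type*) [NormedAddCommGroup V] [NormedSpace ℝ V] : C(I, V) →L[ℝ] C(I, V) :=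
  LinearMap.mkContinuous
    { toFun := fun f => ⟨fun t => ∫ x in (0 : ℝ)..1, IccExtend zero_le_one f (t * x), by
        apply intervalIntegral.continuous_parametric_intervalIntegral_of_continuous'
        exact f.continuous.Icc_extend' |>.comp (by fun_prop)⟩
      map_add' := fun f g => by
        ext t
        have hc : ∀ f : C(I, V), Continuous fun x : ℝ => IccExtend zero_le_one f (t * x) :=
          fun f => f.continuous.Icc_extend' |>.comp (by fun_prop)
        simpa [IccExtend] using intervalIntegral.integral_add (μ := MeasureTheory.volume)
          ((hc f).intervalIntegrable 0 1) ((hc g).intervalIntegrable 0 1)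
      map_smul' := fun c f => by
        ext t
        simp [IccExtend] }
    1 fun f => by
      rw [one_mul, ContinuousMap.norm_le _ (norm_nonneg f)]
      intro t
      have := intervalIntegral.norm_integral_le_of_norm_le_const (a := 0) (b := 1)
        (f := fun x : ℝ => IccExtend zero_le_one f (t * x)) (C := ‖f‖)
        (fun x _ => f.norm_coe_le_norm _)
      simpa using this

theorem avg_apply (f : C(I, V)) (t : I) :
    avg V f t = ∫ x in (0 : ℝ)..1, IccExtend zero_le_one f (t * x) := rfl

theorem smul_avg_apply (f : C(I, V)) (t : I) :
    (t : ℝ) • avg V f t = ∫ τ in (0 : ℝ)..t, IccExtend zero_le_one f τ := by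
  rw [avg_apply, intervalIntegral.smul_integral_comp_mul_left]
  simp

/-- Averaging, unlike integration from `0`, commutes with dilations. This is what later makes the
solution of the singular equation self-similar. -/
theorem avg_comp_mul (f : C(I, V)) (c : I) :
    avg V (f.comp ⟨fun t => c * t, by fun_prop⟩)
      = (avg V f).comp ⟨fun t => c * t, by fun_prop⟩ := by
  ext t
  simp only [ContinuousMap.comp_apply, ContinuousMap.coe_mk, avg_apply]
  refine intervalIntegral.integral_congr fun x hx => ?_
  rw [uIcc_of_le zero_le_one] at hx
  have h1 : (t : ℝ) * x ∈ Icc (0 : ℝ) 1 := (t * ⟨x, hx⟩ : I).2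
  have h2 : ((c * t : I) : ℝ) * x ∈ Icc (0 : ℝ) 1 := (c * t * ⟨x, hx⟩ : I).2
  simp only [IccExtend_of_mem _ _ h1, IccExtend_of_mem _ _ h2, ContinuousMap.comp_apply,
    ContinuousMap.coe_mk]
  congr 1
  ext
  simp [mul_assoc]

/-- The function `t` on the unit interval. -/
def idI : C(I, ℝ) := ⟨Subtype.val, continuous_subtype_val⟩

/-- The Volterra operator `f ↦ ∫₀ᵗ f`. -/
def volterra (V : Type*) [NormedAddCommGroup V] [NormedSpace ℝ V] : C(I, V) →L[ℝ] C(I, V) :=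
  LinearMap.mkContinuous
    { toFun := fun f => ⟨fun t => (t : ℝ) • avg V f t, by fun_prop⟩
      map_add' := fun f g => by ext t; simp
      map_smul' := fun c f => by ext t; simp [smul_comm c] }
    (1 * ‖avg V‖) fun f => by
      rw [ContinuousMap.norm_le _ (by positivity)]
      intro t
      simp only [LinearMap.coe_mk, AddHom.coe_mk, ContinuousMap.coe_mk, norm_smul]
      rw [mul_assoc]
      refine mul_le_mul ?_ (((avg V f).norm_coe_le_norm t).trans ((avg V).le_opNorm f))
        (norm_nonneg _) zero_le_one
      rw [Real.norm_eq_abs, abs_of_nonneg t.2.1]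
      exact t.2.2

theorem volterra_apply (f : C(I, V)) (t : I) :
    volterra V f t = ∫ τ in (0 : ℝ)..t, IccExtend zero_le_one f τ := smul_avg_apply f t

theorem eventually_forall_smul {E : Type*} [NormedAddCommGroup E] [NormedSpace ℝ E] {p : E → Prop}
    (h : ∀ᶠ z in 𝓝 (0 : E), p z) : ∀ᶠ z in 𝓝 (0 : E), ∀ t ∈ Icc (0 : ℝ) 1, p (t • z) := by
  obtain ⟨ε, hε, H⟩ := Metric.eventually_nhds_iff_ball.1 h
  refine Metric.eventually_nhds_iff_ball.2 ⟨ε, hε, fun z hz t ht => H _ ?_⟩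
  rw [mem_ball_zero_iff, norm_smul, Real.norm_eq_abs, abs_of_nonneg ht.1]
  rw [mem_ball_zero_iff] at hz
  exact (mul_le_of_le_one_left (norm_nonneg z) ht.2).trans_lt hz

/-- The monomial `t ↦ t ^ j • x`. -/
def monomialI (V : Type*) [NormedAddCommGroup V] [NormedSpace ℝ V] (j : ℕ) : V →L[ℝ] C(I, V) :=
  LinearMap.mkContinuous
    { toFun := fun x => ⟨fun t => (t : ℝ) ^ j • x, by fun_prop⟩
      map_add' := fun x x' => by ext t; simp
      map_smul' := fun c x => by ext t; simp [smul_comm c] }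
    1 fun x => by
      rw [one_mul, ContinuousMap.norm_le _ (norm_nonneg x)]
      intro t
      simp only [LinearMap.coe_mk, AddHom.coe_mk, ContinuousMap.coe_mk, norm_smul]
      refine mul_le_of_le_one_left (norm_nonneg x) ?_
      rw [norm_pow, Real.norm_eq_abs, abs_of_nonneg t.2.1]
      exact pow_le_one₀ t.2.1 t.2.2

theorem norm_monomialI_le (j : ℕ) : ‖monomialI V j‖ ≤ 1 :=
  LinearMap.mkContinuous_norm_le _ zero_le_one _

/-- The restrictions `t ↦ α (t z)` of an analytic function to segments depend analytically
on `z`. -/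
theorem exists_analyticAt_ray {E : Type*} [NormedAddCommGroup E] [NormedSpace ℝ E]
    [CompleteSpace V] {α : E → V} (hα : AnalyticAt ℝ α 0) :
    ∃ N : E → C(I, V), AnalyticAt ℝ N 0 ∧ ∀ᶠ z in 𝓝 0, ∀ t : I, N z t = α ((t : ℝ) • z) := by
  obtain ⟨p, R, hp⟩ := hα
  -- Since `p j` is homogeneous of degree `j`, its value at `t z` is `t ^ j` times its value at `z`.
  -- The monomials have norm at most one, so the radius of convergence does not shrink.
  let P : FormalMultilinearSeries ℝ E C(I, V) := fun j =>
    (monomialI V j).compContinuousMultilinearMap (p j)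
  have hP : ∀ j, ‖P j‖ ≤ ‖p j‖ := fun j =>
    ((monomialI V j).norm_compContinuousMultilinearMap_le (p j)).trans
      (mul_le_of_le_one_left (norm_nonneg _) (norm_monomialI_le j))
  have hrad : R ≤ P.radius := by
    refine hp.r_le.trans ?_
    refine ENNReal.le_of_forall_nnreal_lt fun r hr => ?_
    refine P.le_radius_of_summable_norm ?_
    refine Summable.of_nonneg_of_le (fun j => by positivity) (fun j => ?_)
      (p.summable_norm_mul_pow hr)
    gcongr
    exact hP j
  have hPs : HasFPowerSeriesOnBall P.sum P 0 R :=
    (P.hasFPowerSeriesOnBall (hp.r_pos.trans_le hrad)).mono hp.r_pos hrad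
  refine ⟨P.sum, hPs.analyticAt, ?_⟩
  have hball : ∀ᶠ z in 𝓝 (0 : E), z ∈ Metric.eball (0 : E) R :=
    Metric.eball_mem_nhds _ hp.r_pos
  filter_upwards [hball, eventually_forall_smul hball] with z hz hz' t
  have h1 := hPs.hasSum hz
  have h2 := hp.hasSum (hz' t t.2)
  have h3 := (ContinuousMap.evalCLM ℝ t).hasSum h1
  simp only [zero_add] at h2 h3
  refine h3.unique ?_
  convert h2 using 2 with j
  simp only [P]
  have := (p j).map_smul_univ (fun _ => (t : ℝ)) (fun _ => z)
  simp only [Finset.prod_const, Finset.card_univ, Fintype.card_fin] at this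
  rw [this]
  rfl

end Rays

/-! ### Parallel frames of flat analytic connections -/

section Frobenius

variable {E : Type*} [NormedAddCommGroup E] [NormedSpace ℝ E]
  {V : Type*} [NormedAddCommGroup V] [NormedSpace ℝ V]

/-- Pointwise evaluation of a path of linear maps at a vector. -/
def pathApply (E V : Type*) [NormedAddCommGroup E] [NormedSpace ℝ E] [NormedAddCommGroup V]
    [NormedSpace ℝ V] : C(I, E →L[ℝ] V) →L[ℝ] E →L[ℝ] C(I, V) :=
  LinearMap.mkContinuous₂
    (LinearMap.mk₂ ℝ (fun (f : C(I, E →L[ℝ] V)) (z : E) => (⟨fun t => f t z, by fun_prop⟩ : C(I, V)))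
      (fun f g z => by ext t; simp) (fun c f z => by ext t; simp)
      (fun f z w => by ext t; simp) (fun c f z => by ext t; simp))
    1 fun f z => by
      rw [one_mul, ContinuousMap.norm_le _ (by positivity)]
      intro t
      exact ((f t).le_opNorm z).trans
        (mul_le_mul_of_nonneg_right (f.norm_coe_le_norm t) (norm_nonneg z))

theorem pathApply_apply (f : C(I, E →L[ℝ] V)) (z : E) (t : I) : pathApply E V f z t = f t z := rfl

/-- Solution of `y = x₀ + T (M z) y` by inversion of `1 - T (M z)`. -/
theorem exists_analyticAt_fixedPoint {X : Type*} [NormedAddCommGroup X] [NormedSpace ℝ X]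
    [CompleteSpace X] (T : X →L[ℝ] X →L[ℝ] X) {M : E → X} (hM : AnalyticAt ℝ M 0) (hM0 : M 0 = 0)
    (x₀ : X) :
    ∃ y : E → X, y 0 = x₀ ∧ AnalyticAt ℝ y 0 ∧ ∀ᶠ z in 𝓝 0, y z = x₀ + T (M z) (y z) ∧
      (∀ v, fderiv ℝ y z v = T (fderiv ℝ M z v) (y z) + T (M z) (fderiv ℝ y z v)) ∧
      ∀ w, w = T (M z) w → w = 0 := by
  let K : E → (X →L[ℝ] X) := fun z => T (M z)
  have hK : AnalyticAt ℝ K 0 := (T.analyticAt _).comp hM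
  have hK0 : K 0 = 0 := by simp [K, hM0]
  have h1K : (1 : X →L[ℝ] X) - K 0 = 1 := by rw [hK0, sub_zero]
  have hunit0 : IsUnit (1 - K 0) := by rw [h1K]; exact isUnit_one
  have hunit : ∀ᶠ z in 𝓝 0, IsUnit (1 - K z) := by
    have hc : ContinuousAt (fun z => 1 - K z) 0 := continuousAt_const.sub hK.continuousAt
    exact hc.eventually (Units.isOpen.mem_nhds hunit0)
  let y : E → X := fun z => Ring.inverse (1 - K z) x₀
  have hy : AnalyticAt ℝ y 0 := by
    have h1 : AnalyticAt ℝ (fun z => Ring.inverse (1 - K z)) 0 := by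
      refine AnalyticAt.fun_comp (g := Ring.inverse) ?_ (analyticAt_const.sub hK)
      exact analyticAt_inverse (𝕜 := ℝ) hunit0.unit
    exact ((ContinuousLinearMap.id ℝ (X →L[ℝ] X)).analyticAt_bilinear (_, _)).comp₂ h1
      analyticAt_const
  have hyK : ∀ᶠ z in 𝓝 0, y z = x₀ + T (M z) (y z) := by
    filter_upwards [hunit] with z hz
    have := congrArg (fun L : X →L[ℝ] X => L x₀) (Ring.mul_inverse_cancel _ hz)
    exact sub_eq_iff_eq_add.1 this
  refine ⟨y, by simp only [y, h1K, Ring.inverse_one]; rfl, hy, ?_⟩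
  filter_upwards [hunit, hyK.eventually_nhds, hy.eventually_analyticAt, hM.eventually_analyticAt]
    with z hz hyz hya hMa
  refine ⟨hyz.self_of_nhds, fun v => ?_, fun w hw => ?_⟩
  · have h1 : HasFDerivAt (fun w => x₀ + T (M w) (y w)) _ z :=
      ((T.hasFDerivAt.comp z hMa.differentiableAt.hasFDerivAt).clm_apply
        hya.differentiableAt.hasFDerivAt).const_add x₀
    have h2 := congrArg (fun L : E →L[ℝ] X => L v) (h1.congr_of_eventuallyEq hyz).fderiv
    simpa [add_comm] using h2
  · have h1 := congrArg (fun L : X →L[ℝ] X => L w) (Ring.inverse_mul_cancel _ hz)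
    have h2 : (1 - K z) w = 0 := sub_eq_zero.2 hw
    simpa [h2] using h1.symm

theorem hasFDerivAt_eval {N : E → C(I, V)} {N' : E →L[ℝ] C(I, V)} {z : E}
    (h : HasFDerivAt N N' z) (t : I) :
    HasFDerivAt (fun w => N w t) ((ContinuousMap.evalCLM ℝ t).comp N') z := by
  have := ((ContinuousMap.evalCLM ℝ t : C(I, V) →L[ℝ] V).hasFDerivAt (x := N z))
  exact HasFDerivAt.comp (g := (ContinuousMap.evalCLM ℝ t : C(I, V) →L[ℝ] V)) z this h

variable {𝔸 : Type*} [NormedRing 𝔸] [NormedAlgebra ℝ 𝔸]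

/-- The bilinear map `(f, g) ↦ ∫₀ᵗ f g`. -/
def volterraMul (𝔸 : Type*) [NormedRing 𝔸] [NormedAlgebra ℝ 𝔸] :
    C(I, 𝔸) →L[ℝ] C(I, 𝔸) →L[ℝ] C(I, 𝔸) :=
  (ContinuousLinearMap.compL ℝ _ _ _ (volterra 𝔸)) ∘L (ContinuousLinearMap.mul ℝ C(I, 𝔸))

theorem volterraMul_apply (f g : C(I, 𝔸)) : volterraMul 𝔸 f g = volterra 𝔸 (f * g) := rfl

/-- An analytic flat connection in a trivial bundle has an analytic parallel frame. -/
theorem exists_analyticAt_parallel [CompleteSpace 𝔸] (α : E → E →L[ℝ] 𝔸) (hα : AnalyticAt ℝ α 0)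
    (hflat : ∀ᶠ z in 𝓝 0, ∀ u v, fderiv ℝ α z u v + α z v * α z u
      = fderiv ℝ α z v u + α z u * α z v) :
    ∃ Y : E → 𝔸, Y 0 = 1 ∧ AnalyticAt ℝ Y 0 ∧
      ∀ᶠ z in 𝓝 0, ∀ v, fderiv ℝ Y z v = α z v * Y z := by
  obtain ⟨N, hN, hNα⟩ := exists_analyticAt_ray hα
  -- Along the ray `t z` a parallel frame satisfies `dy/dt = α (t z) z * y`, that is, `y = 1 + ∫ M
  -- y`; its value at `t = 1` defines the frame at `z`.
  let M : E → C(I, 𝔸) := fun z => pathApply E 𝔸 (N z) z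
  have hM : AnalyticAt ℝ M 0 :=
    ((pathApply E 𝔸).analyticAt_bilinear (N 0, 0)).comp₂ hN analyticAt_id
  obtain ⟨y, hy0, hy, hyz⟩ := exists_analyticAt_fixedPoint (volterraMul 𝔸) hM (by simp [M]) 1
  have hαd : ∀ᶠ z in 𝓝 0, ∀ t ∈ Icc (0 : ℝ) 1, AnalyticAt ℝ α (t • z) :=
    eventually_forall_smul hα.eventually_analyticAt
  refine ⟨fun z => y z 1, by simp [hy0], ?_, ?_⟩
  · refine AnalyticAt.fun_comp (g := (ContinuousMap.evalCLM ℝ (1 : I) : C(I, 𝔸) →L[ℝ] 𝔸)) ?_ hy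
    apply ContinuousLinearMap.analyticAt
  filter_upwards [hyz, hy.eventually_analyticAt, hM.eventually_analyticAt, hαd,
    eventually_forall_smul hflat, hNα.eventually_nhds]
    with z ⟨hyK, hDyK, huniq⟩ hya hMa hαz hfl hNz v
  have hNe := hNz.self_of_nhds
  have hMe : ∀ t : I, M z t = α ((t : ℝ) • z) z := fun t => by
    simp only [M, pathApply_apply, hNe]
  have hMd : ∀ t : I, fderiv ℝ M z v t
      = (t : ℝ) • fderiv ℝ α ((t : ℝ) • z) v z + α ((t : ℝ) • z) v := by
    intro t
    have h1 := hasFDerivAt_eval hMa.differentiableAt.hasFDerivAt t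
    have h2 : HasFDerivAt (fun w => α ((t : ℝ) • w) w) _ z :=
      ((hαz t t.2).differentiableAt.hasFDerivAt.comp z
        ((hasFDerivAt_id z).const_smul (t : ℝ))).clm_apply (hasFDerivAt_id z)
    have h3 : (fun w => M w t) =ᶠ[𝓝 z] fun w => α ((t : ℝ) • w) w := by
      filter_upwards [hNz] with w hw
      simp only [M, pathApply_apply, hw]
    have := congrArg (fun L : E →L[ℝ] 𝔸 => L v) (h1.unique (h2.congr_of_eventuallyEq h3))
    simpa [add_comm] using this
  set Dy := fderiv ℝ y z v with hDy
  have hDyv : fderiv ℝ (fun z => y z 1) z v = Dy 1 :=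
    congrArg (fun L : E →L[ℝ] 𝔸 => L v)
      (hasFDerivAt_eval hya.differentiableAt.hasFDerivAt (1 : I)).fderiv
  -- `A t` is the value of the connection form that `Dy` has to have
  let A : C(I, 𝔸) := idI • (pathApply E 𝔸 (N z) v * y z)
  have hA : ∀ t : I, A t = (t : ℝ) • (α ((t : ℝ) • z) v * y z t) := fun t => by
    simp [A, pathApply_apply, hNe, idI]
  suffices h : Dy - A = 0 by
    have := congrArg (fun f : C(I, 𝔸) => f 1) (sub_eq_zero.1 h)
    simp only [hA] at this
    rw [hDyv, this]
    simp
  apply huniq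
  -- Flatness enters here: it makes `A` solve the linearized Volterra equation, the one satisfied by
  -- `Dy`. The difference `Dy - A` solves the homogeneous equation and so vanishes.
  have key : A = volterra 𝔸 (fderiv ℝ M z v * y z) + volterra 𝔸 (M z * A) := by
    rw [← map_add]
    set F := fderiv ℝ M z v * y z + M z * A
    let q : ℝ → 𝔸 := fun x => 1 + ∫ τ in (0 : ℝ)..x, IccExtend zero_le_one (M z * y z) τ
    have hq : ∀ t : I, q t = y z t := fun t => by
      rw [hyK]
      simp only [q, volterraMul_apply, ContinuousMap.add_apply, volterra_apply,
        ContinuousMap.one_apply]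
    have hqd : ∀ t : I, HasDerivAt q (M z t * y z t) t := fun t => by
      have hc : Continuous (IccExtend zero_le_one (M z * y z)) :=
        (M z * y z).continuous.Icc_extend'
      have := (hc.integral_hasStrictDerivAt 0 (t : ℝ)).hasDerivAt.const_add (1 : 𝔸)
      rwa [IccExtend_val] at this
    ext t
    rw [volterra_apply]
    have hderiv : ∀ x ∈ uIcc (0 : ℝ) t, HasDerivAt (fun x : ℝ => x • (α (x • z) v * q x))
        (IccExtend zero_le_one F x) x := by
      intro x hx
      rw [uIcc_of_le t.2.1] at hx
      have hxI : x ∈ Icc (0 : ℝ) 1 := ⟨hx.1, hx.2.trans t.2.2⟩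
      have h1 : HasDerivAt (fun x : ℝ => α (x • z) v) (fderiv ℝ α (x • z) z v) x := by
        have h := (hαz x hxI).differentiableAt.hasFDerivAt.comp_hasDerivAt x
          ((hasDerivAt_id x).smul_const z)
        simpa using h.clm_apply (hasDerivAt_const x v)
      have h2 := (hasDerivAt_id x).smul (h1.mul (hqd ⟨x, hxI⟩))
      refine h2.congr_deriv ?_
      have h3 := hfl x hxI z v
      have h4 : fderiv ℝ α (x • z) z v * y z ⟨x, hxI⟩
            + α (x • z) v * (α (x • z) z * y z ⟨x, hxI⟩)
          = fderiv ℝ α (x • z) v z * y z ⟨x, hxI⟩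
            + α (x • z) z * (α (x • z) v * y z ⟨x, hxI⟩) := by
        rw [← mul_assoc, ← mul_assoc, ← add_mul, ← add_mul, h3]
      rw [IccExtend_of_mem _ _ hxI]
      simp only [F, ContinuousMap.add_apply, ContinuousMap.mul_apply, hMd, hMe, hA,
        hq ⟨x, hxI⟩, id, one_smul, Pi.mul_apply]
      rw [h4, smul_add, add_mul, smul_mul_assoc, mul_smul_comm]
      abel
    rw [intervalIntegral.integral_eq_sub_of_hasDerivAt hderiv
      (F.continuous.Icc_extend'.intervalIntegrable _ _), zero_smul, sub_zero, hA, hq]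
  have h2 := hDyK v
  rw [← hDy, volterraMul_apply, volterraMul_apply] at h2
  rw [volterraMul_apply, mul_sub, map_sub]
  nth_rewrite 1 [h2, key]
  abel

end Frobenius

/-! ### The Hazzidakis equation at its singular point -/

section SingularODE

/-- Local analytic solution of `g = s • Φ (s, g)`. -/
theorem exists_analyticAt_smul_fixedPoint {X : Type*} [NormedAddCommGroup X] [NormedSpace ℝ X]
    [CompleteSpace X] {Φ : ℝ × X → X} (hΦ : AnalyticAt ℝ Φ 0) :
    ∃ g : ℝ → X, g 0 = 0 ∧ AnalyticAt ℝ g 0 ∧ (∀ᶠ s in 𝓝 0, g s = s • Φ (s, g s)) ∧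
      ∀ᶠ p : ℝ × X in 𝓝 0, p.2 = p.1 • Φ p → p.2 = g p.1 := by
  let f : ℝ × X → X := fun p => p.2 - p.1 • Φ p
  have hf : ContDiffAt ℝ ω f 0 :=
    ((analyticAt_snd.sub (analyticAt_fst.smul hΦ)) : AnalyticAt ℝ f 0).contDiffAt
  have hf0 : f 0 = 0 := by simp [f]
  have hd : HasFDerivAt f _ 0 :=
    hasFDerivAt_snd.sub (hasFDerivAt_fst.smul hΦ.differentiableAt.hasFDerivAt)
  -- The factor `p.1` vanishes at the origin, so `Φ` contributes nothing to the derivative in the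
  -- `X`-direction.
  have hinv : (fderiv ℝ f 0 ∘L .inr ℝ ℝ X) = ContinuousLinearMap.id ℝ X := by
    rw [hd.fderiv]
    ext x
    simp
  have if₂ : (fderiv ℝ f 0 ∘L .inr ℝ ℝ X).IsInvertible := by
    rw [hinv]
    exact ⟨ContinuousLinearEquiv.refl ℝ X, rfl⟩
  have hne : (ω : ℕ∞ω) ≠ 0 := by simp
  refine ⟨hf.implicitFunction hne if₂, hf.implicitFunction_apply_self hne if₂, ?_, ?_, ?_⟩
  · have := hf.contDiffAt_implicitFunction hne if₂
    exact this.analyticAt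
  · filter_upwards [hf.eventually_apply_implicitFunction hne if₂] with s hs
    rw [hf0] at hs
    exact sub_eq_zero.1 hs
  · filter_upwards [hf.eventually_apply_eq_iff_implicitFunction hne if₂] with p hp h
    rw [hf0] at hp
    exact (hp.1 (sub_eq_zero.2 h)).symm

/-- The contraction `t ↦ c t` of the unit interval. -/
def dilI (c : I) : C(I, I) := ⟨fun t => c * t, by fun_prop⟩

/-- The substitution `τ = s x` turns ray averages back into integrals over `[0, s]`, from which the
differential equations are recovered. -/
theorem mul_avg_ray {f : C(I, ℝ)} {F : ℝ → ℝ} {s : ℝ} (h : ∀ t : I, f t = F (t * s)) :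
    s * avg ℝ f 1 = ∫ x in (0 : ℝ)..s, F x := by
  have h1 : avg ℝ f 1 = ∫ x in (0 : ℝ)..1, F (s * x) := by
    rw [avg_apply]
    refine intervalIntegral.integral_congr fun x hx => ?_
    rw [uIcc_of_le zero_le_one] at hx
    simp only [Icc.coe_one, one_mul, IccExtend_of_mem _ _ hx, h, mul_comm s]
  rw [h1, intervalIntegral.mul_integral_comp_mul_left]
  simp

theorem hasDerivAt_of_eventually_eq_integral {F u : ℝ → ℝ} (hF : ∀ᶠ x in 𝓝 0, ContinuousAt F x)
    (hu : ∀ᶠ x in 𝓝 0, u x = u 0 + ∫ τ in (0 : ℝ)..x, F τ) :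
    ∀ᶠ x in 𝓝 0, HasDerivAt u (F x) x := by
  obtain ⟨ε, hε, H⟩ := Metric.eventually_nhds_iff_ball.1 hF
  filter_upwards [hu.eventually_nhds, Metric.ball_mem_nhds 0 hε] with x hx hxε
  have hsub : uIcc 0 x ⊆ Metric.ball 0 ε := by
    rw [← segment_eq_uIcc]
    exact (convex_ball 0 ε).segment_subset (Metric.mem_ball_self hε) hxε
  have hcont : ContinuousOn F (uIcc 0 x) := fun y hy => (H y (hsub hy)).continuousWithinAt
  have hmeas : StronglyMeasurableAtFilter F (𝓝 x) :=
    ContinuousAt.stronglyMeasurableAtFilter (s := Metric.ball 0 ε) Metric.isOpen_ball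
      (fun y hy => H y hy) x hxε
  have h1 := intervalIntegral.integral_hasDerivAt_right hcont.intervalIntegrable hmeas (H x hxε)
  exact (h1.const_add (u 0)).congr_of_eventuallyEq hx

/-- Evaluation at `t` is a continuous algebra homomorphism, so the Banach-algebra exponential, known
to be analytic, is the pointwise one. -/
theorem exp_continuousMap_apply (f : C(I, ℝ)) (t : I) :
    NormedSpace.exp f t = Real.exp (f t) := by
  have := NormedSpace.map_exp (ContinuousMap.evalAlgHom ℝ ℝ t)
    (by exact continuous_eval_const t) f
  rw [Real.exp_eq_exp_ℝ]
  exact this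

variable (J : ℕ) (h₀ G₀ : ℝ)

/-- The function `G = h' / s ^ J` along a ray. -/
def pathG (g : C(I, ℝ)) : C(I, ℝ) := G₀ • NormedSpace.exp g

/-- The function `h` along a ray. -/
def pathH (s : ℝ) (g : C(I, ℝ)) : C(I, ℝ) :=
  algebraMap ℝ _ h₀ + (s • idI) * avg ℝ ((s • idI) ^ J * pathG G₀ g)

/-- The right-hand side of the Hazzidakis equation along a ray; `N` is the function
`(J + 2) ^ 2 / (1 - x ^ (J + 2)) ^ 2` along the ray. -/
def pathK (N : ℝ → C(I, ℝ)) (p : ℝ × C(I, ℝ)) : C(I, ℝ) :=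
  (p.1 • idI) ^ J * pathG G₀ p.2
    -- The factor `pathG G₀⁻¹ (-p.2)` is `1 / G`, written without division so that analyticity in
    -- `C(I, ℝ)` is immediate.
    + N p.1 * (2 * (p.1 • idI) ^ (J + 1) - pathH J h₀ G₀ p.1 p.2 ^ 2 * pathG G₀⁻¹ (-p.2))

theorem analyticAt_pathG {f : ℝ × C(I, ℝ) → C(I, ℝ)} {p} (hf : AnalyticAt ℝ f p) :
    AnalyticAt ℝ (fun p => pathG G₀ (f p)) p :=
  (analyticAt_const (v := G₀)).fun_smul
    ((NormedSpace.exp_analytic (𝕂 := ℝ) (f p)).fun_comp hf)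

theorem analyticAt_avg {f : ℝ × C(I, ℝ) → C(I, ℝ)} {p} (hf : AnalyticAt ℝ f p) :
    AnalyticAt ℝ (fun p => avg ℝ (f p)) p := by
  refine AnalyticAt.fun_comp (g := avg ℝ) ?_ hf
  apply ContinuousLinearMap.analyticAt

theorem analyticAt_pathK {N : ℝ → C(I, ℝ)} (hN : AnalyticAt ℝ N 0) :
    AnalyticAt ℝ (pathK J h₀ G₀ N) 0 := by
  have h1 : AnalyticAt ℝ (fun p : ℝ × C(I, ℝ) => p.1 • idI) 0 :=
    analyticAt_fst.smul analyticAt_const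
  have h2 : AnalyticAt ℝ (fun p : ℝ × C(I, ℝ) => pathH J h₀ G₀ p.1 p.2) 0 :=
    analyticAt_const.add (h1.mul (analyticAt_avg ((h1.pow J).mul
      (analyticAt_pathG G₀ analyticAt_snd))))
  have h3 : AnalyticAt ℝ (fun p : ℝ × C(I, ℝ) => N p.1) 0 :=
    AnalyticAt.fun_comp (f := Prod.fst) hN analyticAt_fst
  exact ((h1.pow J).mul (analyticAt_pathG G₀ analyticAt_snd)).add
    (h3.mul ((analyticAt_const.mul (h1.pow (J + 1))).sub
      ((h2.pow 2).mul (analyticAt_pathG _ analyticAt_snd.neg))))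

theorem pathG_apply (g : C(I, ℝ)) (t : I) : pathG G₀ g t = G₀ * Real.exp (g t) := by
  simp [pathG, exp_continuousMap_apply]

theorem pathG_comp (g : C(I, ℝ)) (c : I) :
    (pathG G₀ g).comp (dilI c) = pathG G₀ (g.comp (dilI c)) := by
  ext t
  simp [pathG_apply]

theorem smul_idI_comp (s : ℝ) (c : I) : (s • idI).comp (dilI c) = (c * s) • idI := by
  ext t
  simp [idI, dilI]
  ring

theorem pathH_comp (s : ℝ) (g : C(I, ℝ)) (c : I) :
    (pathH J h₀ G₀ s g).comp (dilI c) = pathH J h₀ G₀ (c * s) (g.comp (dilI c)) := by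
  have h := avg_comp_mul ((s • idI) ^ J * pathG G₀ g) c
  have h2 : (((s • idI) ^ J * pathG G₀ g).comp (dilI c))
      = ((c * s) • idI) ^ J * pathG G₀ (g.comp (dilI c)) := by
    rw [← smul_idI_comp, ← pathG_comp]
    rfl
  rw [pathH, pathH, ← h2, ← smul_idI_comp]
  change _ = _ + _ * avg ℝ (ContinuousMap.comp _ ⟨fun t => c * t, _⟩)
  rw [h]
  rfl

/-- The right-hand side has no scale of its own: shortening the ray by `c` amounts to replacing `s`
by `c s`. -/
theorem pathK_comp {N : ℝ → C(I, ℝ)} {s : ℝ} {c : I} (hN : (N s).comp (dilI c) = N (c * s))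
    (g : C(I, ℝ)) :
    (pathK J h₀ G₀ N (s, g)).comp (dilI c) = pathK J h₀ G₀ N (c * s, g.comp (dilI c)) := by
  simp only [pathK]
  rw [← pathH_comp, ← smul_idI_comp, ← hN, ← pathG_comp]
  have : pathG G₀⁻¹ (-g.comp (dilI c)) = (pathG G₀⁻¹ (-g)).comp (dilI c) := by
    ext t; simp [pathG_apply]
  rw [this]
  rfl

/-- Analytic solutions of the Hazzidakis equation with `h = h₀ + s ^ (J + 1) B` at the singular
point `s = 0`, as a first-order system for `h`, `g = log (h' / (s ^ J G₀))` and `P = g'`. -/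
theorem exists_analyticAt_hazzidakis (hG₀ : G₀ ≠ 0) :
    ∃ B g P : ℝ → ℝ, AnalyticAt ℝ B 0 ∧ AnalyticAt ℝ g 0 ∧ AnalyticAt ℝ P 0 ∧ g 0 = 0 ∧
      B 0 = G₀ / (J + 1) ∧ ∀ᶠ x in 𝓝 0,
        HasDerivAt (fun x => h₀ + x ^ (J + 1) * B x) (x ^ J * (G₀ * Real.exp (g x))) x ∧
        HasDerivAt g (P x) x ∧
        HasDerivAt (fun x => x * P x) (x ^ J * (G₀ * Real.exp (g x))
          + ((J : ℝ) + 2) ^ 2 / (1 - x ^ (J + 2)) ^ 2 * (2 * x ^ (J + 1)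
            - (h₀ + x ^ (J + 1) * B x) ^ 2 / (G₀ * Real.exp (g x)))) x := by
  let q : ℝ → ℝ := fun x => ((J : ℝ) + 2) ^ 2 / (1 - x ^ (J + 2)) ^ 2
  have hq : AnalyticAt ℝ q 0 :=
    analyticAt_const.div ((analyticAt_const.sub (analyticAt_id.pow _)).pow 2) (by simp)
  obtain ⟨N, hN, hNq⟩ := exists_analyticAt_ray hq
  have hK := analyticAt_pathK J h₀ G₀ hN
  -- From `(x P)' = K` comes `P = avg K`, and from `g' = P`, `g 0 = 0` comes `g = x avg P`. At `x =
  -- s t` this reads `y = s • Φ (s, y)`.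
  let Φ : ℝ × C(I, ℝ) → C(I, ℝ) := fun p => idI * avg ℝ (avg ℝ (pathK J h₀ G₀ N p))
  have hΦ : AnalyticAt ℝ Φ 0 := analyticAt_const.mul (analyticAt_avg (analyticAt_avg hK))
  obtain ⟨y, hy0, hy, hyΦ, huniq⟩ := exists_analyticAt_smul_fixedPoint hΦ
  have hpair : AnalyticAt ℝ (fun s => (s, y s)) 0 := AnalyticAt.prod analyticAt_id hy
  have hpair0 : ((0 : ℝ), y 0) = (0 : ℝ × C(I, ℝ)) := by rw [hy0]; rfl
  have heval : ∀ {f : ℝ → C(I, ℝ)}, AnalyticAt ℝ f 0 → AnalyticAt ℝ (fun x => f x 1) 0 := by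
    intro f hf
    refine AnalyticAt.fun_comp (g := (ContinuousMap.evalCLM ℝ (1 : I) : C(I, ℝ) →L[ℝ] ℝ)) ?_ hf
    apply ContinuousLinearMap.analyticAt
  let Kp : ℝ → C(I, ℝ) := fun s => pathK J h₀ G₀ N (s, y s)
  have hKp : AnalyticAt ℝ Kp 0 := AnalyticAt.fun_comp (by rwa [hpair0]) hpair
  have havg : ∀ {f : ℝ → C(I, ℝ)}, AnalyticAt ℝ f 0 → AnalyticAt ℝ (fun x => avg ℝ (f x)) 0 := by
    intro f hf
    refine AnalyticAt.fun_comp (g := avg ℝ) ?_ hf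
    apply ContinuousLinearMap.analyticAt
  have hGp : AnalyticAt ℝ (fun s => pathG G₀ (y s)) 0 :=
    (analyticAt_const (v := G₀)).fun_smul ((NormedSpace.exp_analytic (𝕂 := ℝ) (y 0)).fun_comp hy)
  let B : ℝ → ℝ := fun x => avg ℝ (idI ^ J * pathG G₀ (y x)) 1
  let g : ℝ → ℝ := fun x => y x 1
  let P : ℝ → ℝ := fun x => avg ℝ (Kp x) 1
  let G : ℝ → ℝ := fun x => G₀ * Real.exp (g x)
  let H : ℝ → ℝ := fun x => h₀ + x ^ (J + 1) * B x
  have hB : AnalyticAt ℝ B 0 := heval (havg (analyticAt_const.mul hGp))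
  have hg : AnalyticAt ℝ g 0 := heval hy
  have hP : AnalyticAt ℝ P 0 := heval (havg hKp)
  have hG : AnalyticAt ℝ G 0 := analyticAt_const.mul hg.rexp
  -- self-similarity of the solution
  have hscale : ∀ᶠ s in 𝓝 0, ∀ c : I, (y s).comp (dilI c) = y (c * s) ∧
      (Kp s).comp (dilI c) = Kp (c * s) := by
    obtain ⟨ε, hε, hU⟩ := Metric.eventually_nhds_iff_ball.1 huniq
    have hys : ∀ᶠ s in 𝓝 0, ‖y s‖ < ε := by
      have : Tendsto (fun s => ‖y s‖) (𝓝 0) (𝓝 0) := by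
        simpa [hy0] using hy.continuousAt.norm.tendsto
      exact this.eventually (gt_mem_nhds hε)
    filter_upwards [hyΦ, hNq, eventually_forall_smul hNq, hys, Metric.ball_mem_nhds 0 hε]
      with s hs hNs hNs' hysε hsε c
    have hNc : (N s).comp (dilI c) = N (c * s) := by
      ext t
      rw [← smul_eq_mul (c : ℝ), hNs' c c.2]
      simp only [ContinuousMap.comp_apply, hNs]
      simp [dilI]
      ring_nf
    have hKc := pathK_comp J h₀ G₀ hNc (y s)
    have hyc : (y s).comp (dilI c) = y (c * s) := by
      -- The dilated ray solves the equation with parameter `c * s` and stays small, so local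
      -- uniqueness identifies it with `y (c * s)`.
      refine hU (c * s, (y s).comp (dilI c)) ?_ ?_
      · rw [mem_ball_zero_iff] at hsε ⊢
        rw [Prod.norm_mk, max_lt_iff]
        constructor
        · rw [norm_mul, Real.norm_eq_abs (c : ℝ), abs_of_nonneg c.2.1]
          exact (mul_le_of_le_one_left (norm_nonneg s) c.2.2).trans_lt hsε
        · refine lt_of_le_of_lt ?_ hysε
          rw [ContinuousMap.norm_le _ (norm_nonneg _)]
          exact fun t => (y s).norm_coe_le_norm _
      · have h1 : (avg ℝ (avg ℝ (pathK J h₀ G₀ N (s, y s)))).comp (dilI c)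
            = avg ℝ (avg ℝ (pathK J h₀ G₀ N (c * s, (y s).comp (dilI c)))) := by
          rw [← hKc]
          exact ((congrArg (avg ℝ) (avg_comp_mul _ c)).symm ▸ avg_comp_mul _ c).symm
        simp only [Φ]
        rw [← h1]
        conv_lhs => rw [hs]
        ext t
        simp [Φ, idI, dilI]
        ring
    refine ⟨hyc, ?_⟩
    simp only [Kp]
    rw [hKc, hyc]
  have hHp : ∀ s, pathH J h₀ G₀ s (y s) 1 = H s := by
    intro s
    have h1 : (s • idI) ^ J * pathG G₀ (y s) = s ^ J • (idI ^ J * pathG G₀ (y s)) := by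
      rw [smul_pow, smul_mul_assoc]
    simp only [pathH, h1, map_smul, H, B, ContinuousMap.add_apply, ContinuousMap.mul_apply,
      ContinuousMap.smul_apply, smul_eq_mul]
    simp [idI]
    ring
  have hKf : ∀ᶠ s in 𝓝 0, Kp s 1 = s ^ J * G s + q s * (2 * s ^ (J + 1) - H s ^ 2 / G s) := by
    filter_upwards [hNq] with s hs
    have h1 := hHp s
    have h2 := hs 1
    have h3 : (2 : C(I, ℝ)) 1 = 2 := rfl
    simp only [Kp, pathK, ContinuousMap.add_apply, ContinuousMap.mul_apply,
      ContinuousMap.sub_apply, ContinuousMap.pow_apply, ContinuousMap.smul_apply, pathG_apply,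
      h1, h2, h3]
    simp [idI, G, g, Real.exp_neg, q]
    left
    field_simp
  refine ⟨B, g, P, hB, hg, hP, by simp [g, hy0], ?_, ?_⟩
  · have h1 : pathG G₀ (y 0) = G₀ • (1 : C(I, ℝ)) := by
      ext t
      simp [pathG_apply, hy0]
    have h2 := mul_avg_ray (f := idI ^ J) (F := fun x => x ^ J) (s := 1) fun t => by simp [idI]
    rw [one_mul, integral_pow] at h2
    simp only [B, h1, mul_smul_comm, mul_one, map_smul, ContinuousMap.smul_apply, h2]
    simp [div_eq_mul_inv]
  have hH' : ∀ᶠ x in 𝓝 0, HasDerivAt H (x ^ J * G x) x := by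
    refine hasDerivAt_of_eventually_eq_integral
      ((analyticAt_id.pow J).mul hG).eventually_continuousAt ?_
    filter_upwards [hscale] with s hs
    have h1 := mul_avg_ray (f := (s • idI) ^ J * pathG G₀ (y s)) (F := fun x => x ^ J * G x)
      (s := s) fun t => by
        have h2 : y s t = y (t * s) 1 := by rw [← (hs t).1]; simp [dilI]
        simp [pathG_apply, idI, G, g, h2, mul_comm s]
    rw [← h1, ← hHp s]
    simp [pathH, H, idI]
  have hg' : ∀ᶠ x in 𝓝 0, HasDerivAt g (P x) x := by
    refine hasDerivAt_of_eventually_eq_integral hP.eventually_continuousAt ?_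
    filter_upwards [hscale, hyΦ] with s hs hyΦs
    have h1 := mul_avg_ray (f := avg ℝ (Kp s)) (F := P) (s := s) fun t => by
      have h2 := congrArg (fun f : C(I, ℝ) => f 1) (avg_comp_mul (Kp s) t)
      have h3 : (Kp s).comp ⟨fun x => t * x, by fun_prop⟩ = Kp (t * s) := (hs t).2
      rw [h3] at h2
      simpa using h2.symm
    rw [← h1]
    have h2 := congrArg (fun f : C(I, ℝ) => f 1) hyΦs
    simpa [g, hy0, Φ, idI, Kp] using h2
  have hP' : ∀ᶠ x in 𝓝 0, HasDerivAt (fun x => x * P x) (Kp x 1) x := by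
    refine hasDerivAt_of_eventually_eq_integral (heval hKp).eventually_continuousAt ?_
    filter_upwards [hscale] with s hs
    have h1 := mul_avg_ray (f := Kp s) (F := fun x => Kp x 1) (s := s) fun t => by
      rw [← (hs t).2]; simp [dilI]
    rw [← h1]
    simp [P]
  filter_upwards [hH', hg', hP', hKf] with x h1 h2 h3 h4
  rw [h4] at h3
  exact ⟨h1, h2, h3⟩

end SingularODE

end BonnetSurface

namespace BonnetSurface

open Set Filter

/-! ### The moving frame equations -/

section Frame

theorem eventually_eq_of_hasFDerivAt_zero {E F : Type*} [NormedAddCommGroup E] [NormedSpace ℝ E]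
    [NormedAddCommGroup F] [NormedSpace ℝ F] {c : E → F} {z : E}
    (h : ∀ᶠ w in 𝓝 z, HasFDerivAt c (0 : E →L[ℝ] F) w) : ∀ᶠ w in 𝓝 z, c w = c z := by
  obtain ⟨ε, hε, H⟩ := Metric.eventually_nhds_iff_ball.1 h
  filter_upwards [Metric.ball_mem_nhds z hε] with w hw
  exact Metric.isOpen_ball.is_const_of_fderiv_eq_zero (convex_ball z ε).isPreconnected
    (fun x hx => (H x hx).differentiableAt.differentiableWithinAt)
    (fun x hx => (H x hx).fderiv) hw (Metric.mem_ball_self hε)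

/-- The connection matrix in the `x`-direction of a moving frame `(e₁, e₂, n)` together with the
surface. -/
def frameX (a l m ρ : ℝ) : Matrix (Fin 4) (Fin 4) ℝ :=
  !![0, a, l, 0; -a, 0, m, 0; -l, -m, 0, 0; ρ, 0, 0, 0]

/-- The connection matrix in the `y`-direction. -/
def frameY (b m k ρ : ℝ) : Matrix (Fin 4) (Fin 4) ℝ :=
  !![0, b, m, 0; -b, 0, k, 0; -m, -k, 0, 0; 0, ρ, 0, 0]

theorem frameX_eq (a l m ρ : ℝ) : frameX a l m ρ = a • frameX 1 0 0 0 + l • frameX 0 1 0 0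
    + m • frameX 0 0 1 0 + ρ • frameX 0 0 0 1 := by
  ext i j; fin_cases i <;> fin_cases j <;> simp [frameX]

theorem frameY_eq (b m k ρ : ℝ) : frameY b m k ρ = b • frameY 1 0 0 0 + m • frameY 0 1 0 0
    + k • frameY 0 0 1 0 + ρ • frameY 0 0 0 1 := by
  ext i j; fin_cases i <;> fin_cases j <;> simp [frameY]

/-- Zero curvature, read entry by entry: `hG` is the Gauss equation, `h₁` and `h₂` are the Codazzi
equations, and `hx`, `hy` express the symmetry of the mixed second derivative of the surface. -/
theorem frame_integrable {a b l m k ρ ay bx ly my mx kx ρx ρy : ℝ}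
    (hG : ay - l * k = bx - m ^ 2) (h₁ : a * k + ly = b * m + mx) (h₂ : my - a * m = kx - b * l)
    (hx : ρx = b * ρ) (hy : ρy = -(a * ρ)) :
    frameX ay ly my ρy + frameX a l m ρ * frameY b m k ρ
      = frameY bx mx kx ρx + frameY b m k ρ * frameX a l m ρ := by
  ext i j
  fin_cases i <;> fin_cases j <;>
    simp [frameX, frameY] <;>
    first
    | ring1
    | linear_combination hG
    | linear_combination -hG
    | linear_combination h₁
    | linear_combination -h₁
    | linear_combination h₂
    | linear_combination -h₂
    | linear_combination hx
    | linear_combination hy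
    | linear_combination -hx

theorem fderiv_eq_dx_dy {E : Type*} [NormedAddCommGroup E] [NormedSpace ℝ E] (f : ℂ → E)
    (z v : ℂ) : fderiv ℝ f z v = v.re • dx f z + v.im • dy f z := by
  have : v = v.re • (1 : ℂ) + v.im • Complex.I := by
    simp [Complex.re_add_im]
  conv_lhs => rw [this, map_add, map_smul, map_smul]
  rfl

/-- Two-dimensional form of `exists_analyticAt_parallel`. -/
theorem exists_analyticAt_dx_dy_eq_mul {𝔸 : Type*} [NormedRing 𝔸] [NormedAlgebra ℝ 𝔸]
    [CompleteSpace 𝔸] {A B : ℂ → 𝔸} (hA : AnalyticAt ℝ A 0) (hB : AnalyticAt ℝ B 0)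
    (hAB : ∀ᶠ z in 𝓝 0, dy A z + A z * B z = dx B z + B z * A z) :
    ∃ Y : ℂ → 𝔸, Y 0 = 1 ∧ AnalyticAt ℝ Y 0 ∧ ∀ᶠ z in 𝓝 0,
      dx Y z = A z * Y z ∧ dy Y z = B z * Y z := by
  let S : (ℂ →L[ℝ] ℝ) →L[ℝ] 𝔸 →L[ℝ] ℂ →L[ℝ] 𝔸 := ContinuousLinearMap.smulRightL ℝ ℂ _
  let α : ℂ → ℂ →L[ℝ] 𝔸 := fun z => S Complex.reCLM (A z) + S Complex.imCLM (B z)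
  have hαv : ∀ z v, α z v = v.re • A z + v.im • B z := fun z v => rfl
  have hα : AnalyticAt ℝ α 0 := by
    refine AnalyticAt.add ?_ ?_
    · exact ((S Complex.reCLM).analyticAt _).comp hA
    · exact ((S Complex.imCLM).analyticAt _).comp hB
  obtain ⟨Y, hY0, hY, hYd⟩ := exists_analyticAt_parallel α hα (by
    filter_upwards [hAB, hA.eventually_analyticAt, hB.eventually_analyticAt]
      with z hcomp hAz hBz u v
    have hα' : HasFDerivAt α _ z :=
      ((S Complex.reCLM).hasFDerivAt.comp z hAz.differentiableAt.hasFDerivAt).add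
        ((S Complex.imCLM).hasFDerivAt.comp z hBz.differentiableAt.hasFDerivAt)
    have hα'v : ∀ u v, fderiv ℝ α z u v = v.re • fderiv ℝ A z u + v.im • fderiv ℝ B z u :=
      fun u v => by rw [hα'.fderiv]; rfl
    rw [hα'v, hα'v, hαv, hαv, fderiv_eq_dx_dy A, fderiv_eq_dx_dy A, fderiv_eq_dx_dy B,
      fderiv_eq_dx_dy B]
    simp only [add_mul, mul_add, smul_mul_assoc, mul_smul_comm]
    simp only [dx, dy] at hcomp ⊢
    -- The curvature is alternating in `u` and `v`, so one scalar multiple of the `x`-`y`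
    -- compatibility condition covers all pairs.
    linear_combination (norm := module) (u.im * v.re - u.re * v.im) • hcomp)
  refine ⟨Y, hY0, hY, ?_⟩
  filter_upwards [hYd] with z hz
  refine ⟨(hz 1).trans ?_, (hz Complex.I).trans ?_⟩
  · rw [hαv]; simp
  · rw [hαv]; simp

/-- The space of the coefficient vectors of moving frames. -/
abbrev E4 : Type := EuclideanSpace ℝ (Fin 4)

/-- The `i`-th row of an operator, without its last entry, as a vector of `E3`. -/
def row (i : Fin 4) : (E4 →L[ℝ] E4) →L[ℝ] E3 :=
  ((EuclideanSpace.equiv (Fin 3) ℝ).symm : (Fin 3 → ℝ) →L[ℝ] E3) ∘L ContinuousLinearMap.pi fun a =>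
    (EuclideanSpace.proj i : E4 →L[ℝ] ℝ) ∘L
      (ContinuousLinearMap.apply ℝ E4 (EuclideanSpace.single a.castSucc (1 : ℝ)))

theorem row_apply (i : Fin 4) (T : E4 →L[ℝ] E4) (a : Fin 3) :
    row i T a = T (EuclideanSpace.single a.castSucc 1) i := rfl

/-- Left multiplication combines rows, so the rows of a parallel frame satisfy the frame equations;
each column is a separate solution, so the fourth may be dropped. Row `3` is the surface itself. -/
theorem row_toEuclideanCLM_mul (i : Fin 4) (M : Matrix (Fin 4) (Fin 4) ℝ) (T : E4 →L[ℝ] E4) :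
    row i (Matrix.toEuclideanCLM (𝕜 := ℝ) M * T) = ∑ j, M i j • row j T := by
  ext a
  simp [row_apply, Matrix.mulVec, dotProduct]

/-- The operator of a connection matrix. -/
abbrev frameOp (M : Matrix (Fin 4) (Fin 4) ℝ) : E4 →L[ℝ] E4 := Matrix.toEuclideanCLM (𝕜 := ℝ) M

/-- Linear dependence of the connection matrix on its coefficients, stated as `hM`, lets derivatives
pass to the coefficients. -/
theorem analyticAt_frameOp {c₁ c₂ c₃ c₄ : ℂ → ℝ} {M : ℝ → ℝ → ℝ → ℝ → Matrix (Fin 4) (Fin 4) ℝ}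
    (hM : ∀ a b c d, M a b c d = a • M 1 0 0 0 + b • M 0 1 0 0 + c • M 0 0 1 0 + d • M 0 0 0 1)
    {z : ℂ} (h₁ : AnalyticAt ℝ c₁ z) (h₂ : AnalyticAt ℝ c₂ z) (h₃ : AnalyticAt ℝ c₃ z)
    (h₄ : AnalyticAt ℝ c₄ z) :
    AnalyticAt ℝ (fun z => frameOp (M (c₁ z) (c₂ z) (c₃ z) (c₄ z))) z ∧
      ∀ v, fderiv ℝ (fun z => frameOp (M (c₁ z) (c₂ z) (c₃ z) (c₄ z))) z v
        = frameOp (M (fderiv ℝ c₁ z v) (fderiv ℝ c₂ z v) (fderiv ℝ c₃ z v) (fderiv ℝ c₄ z v)) := by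
  have hM' : ∀ a b c d, frameOp (M a b c d) = a • frameOp (M 1 0 0 0) + b • frameOp (M 0 1 0 0)
      + c • frameOp (M 0 0 1 0) + d • frameOp (M 0 0 0 1) := fun a b c d => by
    simp only [frameOp]
    rw [hM, map_add, map_add, map_add, map_smul, map_smul, map_smul, map_smul]
  have hfun : (fun z => frameOp (M (c₁ z) (c₂ z) (c₃ z) (c₄ z))) = fun z =>
      c₁ z • frameOp (M 1 0 0 0) + c₂ z • frameOp (M 0 1 0 0)
      + c₃ z • frameOp (M 0 0 1 0) + c₄ z • frameOp (M 0 0 0 1) := funext fun z => hM' _ _ _ _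
  rw [hfun]
  refine ⟨(((h₁.smul analyticAt_const).add (h₂.smul analyticAt_const)).add
      (h₃.smul analyticAt_const)).add (h₄.smul analyticAt_const), fun v => ?_⟩
  have h := (((h₁.differentiableAt.hasFDerivAt.smul_const (frameOp (M 1 0 0 0))).add
    (h₂.differentiableAt.hasFDerivAt.smul_const (frameOp (M 0 1 0 0)))).add
    (h₃.differentiableAt.hasFDerivAt.smul_const (frameOp (M 0 0 1 0)))).add
    (h₄.differentiableAt.hasFDerivAt.smul_const (frameOp (M 0 0 0 1)))
  refine Eq.trans ?_ (hM' _ _ _ _).symm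
  exact congrArg (fun L : ℂ →L[ℝ] (E4 →L[ℝ] E4) => L v) h.fderiv

/-- The structure equations are integrable: there is an analytic solution of the frame equations,
with the standard basis as initial frame. -/
theorem exists_analyticAt_frame {a b l m k ρ : ℂ → ℝ} (ha : AnalyticAt ℝ a 0)
    (hb : AnalyticAt ℝ b 0) (hl : AnalyticAt ℝ l 0) (hm : AnalyticAt ℝ m 0)
    (hk : AnalyticAt ℝ k 0) (hρ : AnalyticAt ℝ ρ 0)
    (hG : ∀ᶠ z in 𝓝 0, dy a z - l z * k z = dx b z - m z ^ 2)
    (h₁ : ∀ᶠ z in 𝓝 0, a z * k z + dy l z = b z * m z + dx m z)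
    (h₂ : ∀ᶠ z in 𝓝 0, dy m z - a z * m z = dx k z - b z * l z)
    (hx : ∀ᶠ z in 𝓝 0, dx ρ z = b z * ρ z) (hy : ∀ᶠ z in 𝓝 0, dy ρ z = -(a z * ρ z)) :
    ∃ e : Fin 4 → ℂ → E3, (∀ i, AnalyticAt ℝ (e i) 0) ∧
      (∀ i : Fin 3, e i.castSucc 0 = EuclideanSpace.single i 1) ∧ ∀ᶠ z in 𝓝 0, ∀ i,
        dx (e i) z = ∑ j, frameX (a z) (l z) (m z) (ρ z) i j • e j z ∧
        dy (e i) z = ∑ j, frameY (b z) (m z) (k z) (ρ z) i j • e j z := by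
  obtain ⟨Y, hY0, hY, hYd⟩ := exists_analyticAt_dx_dy_eq_mul
    (analyticAt_frameOp frameX_eq ha hl hm hρ).1 (analyticAt_frameOp frameY_eq hb hm hk hρ).1 (by
      filter_upwards [hG, h₁, h₂, hx, hy, ha.eventually_analyticAt, hb.eventually_analyticAt,
        hl.eventually_analyticAt, hm.eventually_analyticAt, hk.eventually_analyticAt,
        hρ.eventually_analyticAt] with z g1 g2 g3 g4 g5 aa ab al am ak aρ
      rw [dx, dy, (analyticAt_frameOp frameX_eq aa al am aρ).2,
        (analyticAt_frameOp frameY_eq ab am ak aρ).2]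
      simp only [frameOp]
      rw [← map_mul, ← map_mul, ← map_add, ← map_add]
      exact congrArg _ (frame_integrable g1 g2 g3 g4 g5))
  have hrow : ∀ i {z v}, DifferentiableAt ℝ Y z →
      fderiv ℝ (fun z => row i (Y z)) z v = row i (fderiv ℝ Y z v) := fun i z v h =>
    congrArg (fun L : ℂ →L[ℝ] E3 => L v) ((row i).hasFDerivAt.comp z h.hasFDerivAt).fderiv
  refine ⟨fun i z => row i (Y z), fun i => ((row i).analyticAt _).comp hY, fun i => ?_, ?_⟩
  · ext a
    simp only [hY0, row_apply]
    simp [eq_comm]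
  · filter_upwards [hYd, hY.eventually_analyticAt] with z hz hYz i
    rw [dx, dy, hrow i hYz.differentiableAt, hrow i hYz.differentiableAt]
    rw [← row_toEuclideanCLM_mul, ← row_toEuclideanCLM_mul]
    exact ⟨congrArg _ hz.1, congrArg _ hz.2⟩

end Frame

/-! ### From a frame to a surface -/

section SurfaceOfFrame

theorem hasFDerivAt_coord {n : ℕ} {e : ℂ → EuclideanSpace ℝ (Fin n)} {z : ℂ}
    (h : DifferentiableAt ℝ e z) (a : Fin n) :
    ∃ L : ℂ →L[ℝ] ℝ, HasFDerivAt (fun w => e w a) L z ∧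
      ∀ v, L v = v.re * dx e z a + v.im * dy e z a := by
  refine ⟨_, (EuclideanSpace.proj a : EuclideanSpace ℝ (Fin n) →L[ℝ] ℝ).hasFDerivAt.comp z
    h.hasFDerivAt, fun v => ?_⟩
  simp [fderiv_eq_dx_dy]

/-- The matrix `O` with rows `e₀, e₁, e₂` satisfies `dO = A O` with `A` skew, so `Oᵀ O` and `det O`
are constant. The derivative of `O Oᵀ` is a commutator, not visibly zero. Hence the columns are
treated first, and `Oᵀ O = 1` then gives `O Oᵀ = 1`. -/
theorem frame_orthonormal {e : Fin 4 → ℂ → E3} {a b l m k ρ : ℂ → ℝ}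
    (he : ∀ i, AnalyticAt ℝ (e i) 0)
    (he0 : ∀ i : Fin 3, e i.castSucc 0 = EuclideanSpace.single i 1)
    (hd : ∀ᶠ z in 𝓝 0, ∀ i,
        dx (e i) z = ∑ j, frameX (a z) (l z) (m z) (ρ z) i j • e j z ∧
        dy (e i) z = ∑ j, frameY (b z) (m z) (k z) (ρ z) i j • e j z) :
    ∀ᶠ z in 𝓝 0, (∀ i j : Fin 3, inner ℝ (e i.castSucc z) (e j.castSucc z)
        = if i = j then 1 else 0) ∧ cross (e 0 z) (e 1 z) = e 2 z := by
  have hdd : ∀ᶠ z in 𝓝 0, ∀ i, DifferentiableAt ℝ (e i) z :=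
    eventually_all.2 fun i => (he i).eventually_analyticAt.mono fun z h => h.differentiableAt
  have hL : ∀ᶠ z in 𝓝 0, ∃ L : Fin 4 → Fin 3 → ℂ →L[ℝ] ℝ,
      (∀ i c, HasFDerivAt (fun w => e i w c) (L i c) z) ∧ ∀ i c v, L i c v
        = v.re * ∑ j, frameX (a z) (l z) (m z) (ρ z) i j * e j z c
          + v.im * ∑ j, frameY (b z) (m z) (k z) (ρ z) i j * e j z c := by
    filter_upwards [hd, hdd] with z hz hzd
    choose L hL hLv using fun i c => hasFDerivAt_coord (hzd i) c
    refine ⟨L, hL, fun i c v => ?_⟩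
    rw [hLv, (hz i).1, (hz i).2]
    simp
  have hgram : ∀ c d : Fin 3, ∀ᶠ z in 𝓝 0,
      e 0 z c * e 0 z d + e 1 z c * e 1 z d + e 2 z c * e 2 z d = if c = d then 1 else 0 := by
    intro c d
    have h0 : ∀ᶠ z in 𝓝 0, HasFDerivAt
        (fun z => e 0 z c * e 0 z d + e 1 z c * e 1 z d + e 2 z c * e 2 z d)
        (0 : ℂ →L[ℝ] ℝ) z := by
      filter_upwards [hL] with z ⟨L, hL, hLv⟩
      have := (((hL 0 c).mul (hL 0 d)).add ((hL 1 c).mul (hL 1 d))).add ((hL 2 c).mul (hL 2 d))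
      refine this.congr_fderiv (ContinuousLinearMap.ext fun v => ?_)
      simp [hLv, frameX, frameY, Fin.sum_univ_four]
      ring
    filter_upwards [eventually_eq_of_hasFDerivAt_zero h0] with z hz
    rw [hz]
    have h1 := he0 0; have h2 := he0 1; have h3 := he0 2
    simp only [Fin.castSucc_zero, Fin.castSucc_one, Fin.isValue] at h1 h2 h3
    have h3 : e 2 0 = EuclideanSpace.single 2 1 := h3
    rw [h1, h2, h3]
    fin_cases c <;> fin_cases d <;> simp
  have hdet : ∀ᶠ z in 𝓝 0, (Matrix.of fun i c : Fin 3 => e i.castSucc z c).det = 1 := by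
    have h0 : ∀ᶠ z in 𝓝 0, HasFDerivAt
        (fun z => (Matrix.of fun i c : Fin 3 => e i.castSucc z c).det) (0 : ℂ →L[ℝ] ℝ) z := by
      filter_upwards [hL] with z ⟨L, hL, hLv⟩
      have t := fun p q r => ((hL 0 p).mul (hL 1 q)).mul (hL 2 r)
      have := (((((t 0 1 2).sub (t 0 2 1)).sub (t 1 0 2)).add (t 1 2 0)).add (t 2 0 1)).sub
        (t 2 1 0)
      simp only [Matrix.det_fin_three]
      refine this.congr_fderiv (ContinuousLinearMap.ext fun v => ?_)
      simp [hLv, frameX, frameY, Fin.sum_univ_four]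
      ring
    filter_upwards [eventually_eq_of_hasFDerivAt_zero h0] with z hz
    rw [hz]
    simp [he0, Matrix.det_fin_three]
  filter_upwards [hdet, eventually_all.2 fun c => eventually_all.2 (hgram c)] with z hdet hgram
  set O : Matrix (Fin 3) (Fin 3) ℝ := Matrix.of fun i c => e i.castSucc z c with hO
  have hOO : O.transpose * O = 1 := by
    ext c d
    rw [Matrix.mul_apply, Fin.sum_univ_three]
    exact (hgram c d).trans (Matrix.one_apply).symm
  have hOO' := mul_eq_one_comm.1 hOO
  have hinner : ∀ i j : Fin 3, inner ℝ (e i.castSucc z) (e j.castSucc z)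
      = if i = j then 1 else 0 := by
    intro i j
    have := congrFun (congrFun hOO' i) j
    rw [Matrix.mul_apply, Matrix.one_apply] at this
    rw [← this]
    simp [PiLp.inner_apply, O, mul_comm]
  refine ⟨hinner, ?_⟩
  have hentry : ∀ i j : Fin 3, ∑ c : Fin 3, e i.castSucc z c * e j.castSucc z c
      = if i = j then 1 else 0 := fun i j => by
    rw [← hinner i j]
    simp [PiLp.inner_apply, mul_comm]
  have h00 := hentry 0 0; have h01 := hentry 0 1; have h11 := hentry 1 1; have h22 := hentry 2 2
  simp [Fin.sum_univ_three] at h00 h01 h11 h22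
  simp [O, Matrix.det_fin_three] at hdet
  set x := e 0 z; set y := e 1 z; set n := e 2 z
  -- The left side is `‖x × y - n‖² = ‖x‖²‖y‖² - ⟨x, y⟩² - 2 det + ‖n‖²`, which is `1 - 0 - 2 + 1`.
  have hsq : (x 1 * y 2 - x 2 * y 1 - n 0) ^ 2 + (x 2 * y 0 - x 0 * y 2 - n 1) ^ 2
      + (x 0 * y 1 - x 1 * y 0 - n 2) ^ 2 = 0 := by
    linear_combination (y 0 ^ 2 + y 1 ^ 2 + y 2 ^ 2) * h00 + h11
      - (x 0 * y 0 + x 1 * y 1 + x 2 * y 2) * h01 - 2 * hdet + h22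
  have hs : x 1 * y 2 - x 2 * y 1 - n 0 = 0 ∧ x 2 * y 0 - x 0 * y 2 - n 1 = 0 ∧
      x 0 * y 1 - x 1 * y 0 - n 2 = 0 := by
    refine ⟨?_, ?_, ?_⟩ <;> refine pow_eq_zero_iff two_ne_zero |>.1 (le_antisymm ?_ (sq_nonneg _))
    · linarith [sq_nonneg (x 2 * y 0 - x 0 * y 2 - n 1), sq_nonneg (x 0 * y 1 - x 1 * y 0 - n 2)]
    · linarith [sq_nonneg (x 1 * y 2 - x 2 * y 1 - n 0), sq_nonneg (x 0 * y 1 - x 1 * y 0 - n 2)]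
    · linarith [sq_nonneg (x 1 * y 2 - x 2 * y 1 - n 0), sq_nonneg (x 2 * y 0 - x 0 * y 2 - n 1)]
  ext i
  fin_cases i <;> simp [cross, crossProduct] <;> linarith [hs.1, hs.2.1, hs.2.2]

theorem cross_smul_smul (r s : ℝ) (u w : E3) : cross (r • u) (s • w) = (r * s) • cross u w := by
  ext i
  simp only [cross, WithLp.ofLp_smul, map_smul, LinearMap.smul_apply, PiLp.smul_apply,
    Pi.smul_apply, smul_eq_mul]
  ring

theorem fderiv_smul_apply {c : ℂ → ℝ} {e : ℂ → E3} {z : ℂ} (hc : DifferentiableAt ℝ c z)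
    (he : DifferentiableAt ℝ e z) (v : ℂ) :
    fderiv ℝ (fun w => c w • e w) z v = fderiv ℝ c z v • e z + c z • fderiv ℝ e z v := by
  have h := congrArg (fun L : ℂ →L[ℝ] E3 => L v) (hc.hasFDerivAt.smul he.hasFDerivAt).fderiv
  refine h.trans ?_
  simp [add_comm]

/-- Surfaces with prescribed conformal factor `ρ²` and second fundamental form
`ρ (l dx² + 2 m dx dy + k dy²)`, given the structure equations. -/
theorem exists_analyticAt_surface {a b l m k ρ : ℂ → ℝ} (ha : AnalyticAt ℝ a 0)
    (hb : AnalyticAt ℝ b 0) (hl : AnalyticAt ℝ l 0) (hm : AnalyticAt ℝ m 0)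
    (hk : AnalyticAt ℝ k 0) (hρ : AnalyticAt ℝ ρ 0) (hpos : ∀ z, 0 < ρ z)
    (hG : ∀ᶠ z in 𝓝 0, dy a z - l z * k z = dx b z - m z ^ 2)
    (h₁ : ∀ᶠ z in 𝓝 0, a z * k z + dy l z = b z * m z + dx m z)
    (h₂ : ∀ᶠ z in 𝓝 0, dy m z - a z * m z = dx k z - b z * l z)
    (hx : ∀ᶠ z in 𝓝 0, dx ρ z = b z * ρ z) (hy : ∀ᶠ z in 𝓝 0, dy ρ z = -(a z * ρ z)) :
    ∃ f : ℂ → E3, AnalyticAt ℝ f 0 ∧ ∀ᶠ z in 𝓝 0,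
      (dx f z ≠ 0 ∧ ‖dx f z‖ = ‖dy f z‖ ∧ inner ℝ (dx f z) (dy f z) = 0) ∧
      metricCoeff f z = ρ z ^ 2 ∧ meanCurvature f z = (l z + k z) / (2 * ρ z) ∧
      hopf f z = ρ z * (l z - k z - 2 * Complex.I * m z) / 4 := by
  obtain ⟨e, he, he0, hd⟩ := exists_analyticAt_frame ha hb hl hm hk hρ hG h₁ h₂ hx hy
  have hon := frame_orthonormal he he0 hd
  have hdd : ∀ᶠ z in 𝓝 0, ∀ i, DifferentiableAt ℝ (e i) z :=
    eventually_all.2 fun i => (he i).eventually_analyticAt.mono fun z h => h.differentiableAt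
  have hf : ∀ᶠ z in 𝓝 0, dx (e 3) z = ρ z • e 0 z ∧ dy (e 3) z = ρ z • e 1 z := by
    filter_upwards [hd] with z hz
    rw [(hz 3).1, (hz 3).2]
    simp [frameX, frameY, Fin.sum_univ_four]
  refine ⟨e 3, he 3, ?_⟩
  filter_upwards [hd, hon, hdd, hf.eventually_nhds, hρ.eventually_analyticAt]
    with z hdz ⟨hin, hcr⟩ hdiff hfz hρz
  have hi : ∀ i j : Fin 3, inner ℝ (e i.castSucc z) (e j.castSucc z) = if i = j then 1 else 0 := hin
  have h00 : inner ℝ (e 0 z) (e 0 z) = 1 := hi 0 0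
  have h01 : inner ℝ (e 0 z) (e 1 z) = 0 := hi 0 1
  have h11 : inner ℝ (e 1 z) (e 1 z) = 1 := hi 1 1
  have h02 : inner ℝ (e 0 z) (e 2 z) = 0 := hi 0 2
  have h12 : inner ℝ (e 1 z) (e 2 z) = 0 := hi 1 2
  have h22 : inner ℝ (e 2 z) (e 2 z) = 1 := hi 2 2
  have hnorm : ∀ x : E3, inner ℝ x x = 1 → ‖x‖ = 1 := fun x h => by
    rw [real_inner_self_eq_norm_sq] at h
    exact (pow_eq_one_iff_of_nonneg (norm_nonneg _) two_ne_zero).1 h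
  have n0 : ‖e 0 z‖ = 1 := hnorm _ h00
  have n1 : ‖e 1 z‖ = 1 := hnorm _ h11
  have n2 : ‖e 2 z‖ = 1 := hnorm _ h22
  obtain ⟨hfx, hfy⟩ := hfz.self_of_nhds
  have hρ0 := hpos z
  have hnx : ‖dx (e 3) z‖ = ρ z := by rw [hfx, norm_smul, n0, Real.norm_of_nonneg hρ0.le, mul_one]
  have hny : ‖dy (e 3) z‖ = ρ z := by rw [hfy, norm_smul, n1, Real.norm_of_nonneg hρ0.le, mul_one]
  have hN : unitNormal (e 3) z = e 2 z := by
    rw [unitNormal, hfx, hfy, cross_smul_smul, hcr, norm_smul, n2, smul_smul,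
      Real.norm_of_nonneg (by positivity), mul_one, inv_mul_cancel₀ (by positivity), one_smul]
  have hmc : metricCoeff (e 3) z = ρ z ^ 2 := by
    rw [metricCoeff, hnx, hny]; ring
  have hdx : dx (e 3) =ᶠ[𝓝 z] fun w => ρ w • e 0 w := hfz.mono fun w h => h.1
  have hdy : dy (e 3) =ᶠ[𝓝 z] fun w => ρ w • e 1 w := hfz.mono fun w h => h.2
  have hx0 := (hdz 0).1; have hy0 := (hdz 0).2; have hx1 := (hdz 1).1; have hy1 := (hdz 1).2
  simp [frameX, frameY, Fin.sum_univ_four] at hx0 hy0 hx1 hy1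
  have hdxx : inner ℝ (dx (dx (e 3)) z) (e 2 z) = ρ z * l z := by
    rw [dx, hdx.fderiv_eq, fderiv_smul_apply hρz.differentiableAt (hdiff 0)]
    change inner ℝ (_ + _ • dx (e 0) z) _ = _
    rw [hx0]
    simp [inner_add_left, inner_smul_left, h02, h12, n2]
  have hdyy : inner ℝ (dy (dy (e 3)) z) (e 2 z) = ρ z * k z := by
    rw [dy, hdy.fderiv_eq, fderiv_smul_apply hρz.differentiableAt (hdiff 1)]
    change inner ℝ (_ + _ • dy (e 1) z) _ = _
    rw [hy1]
    simp [inner_add_left, inner_smul_left, h02, h12, n2]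
  have hdxy : inner ℝ (dx (dy (e 3)) z) (e 2 z) = ρ z * m z := by
    rw [dx, hdy.fderiv_eq, fderiv_smul_apply hρz.differentiableAt (hdiff 1)]
    change inner ℝ (_ + _ • dx (e 1) z) _ = _
    rw [hx1]
    simp [inner_add_left, inner_smul_left, h02, h12, n2]
  refine ⟨⟨?_, by rw [hnx, hny], ?_⟩, hmc, ?_, ?_⟩
  · rw [← norm_pos_iff, hnx]; exact hρ0
  · rw [hfx, hfy, inner_smul_left, inner_smul_right, h01]; simp
  · rw [meanCurvature, hN, hmc, inner_add_left, hdxx, hdyy]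
    field_simp
  · rw [hopf, hN, inner_sub_left, hdxx, hdyy, hdxy]
    push_cast
    ring

end SurfaceOfFrame

/-! ### Bonnet's theorem in conformal coordinates -/

section FundamentalTheorem

theorem analyticAt_fderiv_apply {E : Type*} [NormedAddCommGroup E] [NormedSpace ℝ E]
    [CompleteSpace E] {v : ℂ → E} {z : ℂ} (hv : AnalyticAt ℝ v z) (u : ℂ) :
    AnalyticAt ℝ (fun w => fderiv ℝ v w u) z :=
  ((ContinuousLinearMap.apply ℝ E u).analyticAt _).comp hv.fderiv

theorem fderiv_mul_exp_add {H v q : ℂ → ℝ} {z : ℂ} (hH : DifferentiableAt ℝ H z)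
    (hv : DifferentiableAt ℝ v z) (hq : DifferentiableAt ℝ q z) (c κ : ℝ) (u : ℂ) :
    fderiv ℝ (fun w => c * (H w * Real.exp (v w)) + κ * (q w * Real.exp (-v w))) z u
      = c * ((fderiv ℝ H z u + H z * fderiv ℝ v z u) * Real.exp (v z))
        + κ * ((fderiv ℝ q z u - q z * fderiv ℝ v z u) * Real.exp (-v z)) := by
  have h := ((hH.hasFDerivAt.mul hv.hasFDerivAt.exp).const_mul c).add
    ((hq.hasFDerivAt.mul hv.hasFDerivAt.neg.exp).const_mul κ)
  refine (congrArg (fun L : ℂ →L[ℝ] ℝ => L u) h.fderiv).trans ?_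
  simp
  ring

/-- Bonnet's theorem in conformal coordinates: the Gauss and Codazzi equations are sufficient for
the existence of a surface with metric `e ^ (2 v) dz dz̄`, mean curvature `H` and Hopf differential
`(q₁ + i q₂) dz²`. -/
theorem exists_analyticAt_of_gauss_codazzi {v H q₁ q₂ : ℂ → ℝ} (hv : AnalyticAt ℝ v 0)
    (hH : AnalyticAt ℝ H 0) (hq₁ : AnalyticAt ℝ q₁ 0) (hq₂ : AnalyticAt ℝ q₂ 0)
    (gauss : ∀ᶠ z in 𝓝 0, dx (dx v) z + dy (dy v) z + H z ^ 2 * Real.exp (v z) ^ 2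
      - 4 * (q₁ z ^ 2 + q₂ z ^ 2) * Real.exp (-v z) ^ 2 = 0)
    (codazzi₁ : ∀ᶠ z in 𝓝 0, dx q₁ z - dy q₂ z = dx H z * Real.exp (v z) ^ 2 / 2)
    (codazzi₂ : ∀ᶠ z in 𝓝 0, dy q₁ z + dx q₂ z = -(dy H z * Real.exp (v z) ^ 2 / 2)) :
    ∃ f : ℂ → E3, AnalyticAt ℝ f 0 ∧ ∀ᶠ z in 𝓝 0,
      (dx f z ≠ 0 ∧ ‖dx f z‖ = ‖dy f z‖ ∧ inner ℝ (dx f z) (dy f z) = 0) ∧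
      metricCoeff f z = Real.exp (v z) ^ 2 ∧ meanCurvature f z = H z ∧
      hopf f z = q₁ z + Complex.I * q₂ z := by
  have hee : ∀ z, Real.exp (v z) * Real.exp (-v z) = 1 := fun z => by
    rw [← Real.exp_add]; simp
  have han : ∀ {q : ℂ → ℝ}, AnalyticAt ℝ q 0 → ∀ c κ : ℝ, AnalyticAt ℝ
      (fun w => c * (H w * Real.exp (v w)) + κ * (q w * Real.exp (-v w))) 0 := fun hq c κ =>
    (analyticAt_const.mul (hH.mul hv.rexp)).add (analyticAt_const.mul (hq.mul hv.neg.rexp))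
  have hall : ∀ᶠ z in 𝓝 0, DifferentiableAt ℝ v z ∧ DifferentiableAt ℝ H z ∧
      DifferentiableAt ℝ q₁ z ∧ DifferentiableAt ℝ q₂ z := by
    filter_upwards [hv.eventually_analyticAt, hH.eventually_analyticAt,
      hq₁.eventually_analyticAt, hq₂.eventually_analyticAt] with z h1 h2 h3 h4
    exact ⟨h1.differentiableAt, h2.differentiableAt, h3.differentiableAt, h4.differentiableAt⟩
  have hexp : ∀ {z} (u : ℂ), DifferentiableAt ℝ v z →
      fderiv ℝ (fun w => Real.exp (v w)) z u = fderiv ℝ v z u * Real.exp (v z) := fun u h => by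
    rw [h.hasFDerivAt.exp.fderiv]; simp [mul_comm]
  -- With `ρ = exp v`, the equations for `ρ` force `a = -v_y` and `b = v_x`. Solving `l + k = 2 ρ H`
  -- and `ρ (l - k - 2 i m) = 4 Q` gives `l, k = H exp v ± 2 q₁ exp (-v)` and `m = -2 q₂ exp (-v)`.
  obtain ⟨f, hf, hfz⟩ := exists_analyticAt_surface (a := fun z => -dy v z) (b := dx v)
    (ρ := fun z => Real.exp (v z))
    (analyticAt_fderiv_apply hv _).neg (analyticAt_fderiv_apply hv _)
    (han hq₁ 1 2) (han hq₂ 0 (-2)) (han hq₁ 1 (-2)) hv.rexp (fun z => Real.exp_pos _)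
    (by
      filter_upwards [gauss] with z hz
      have h1 : dy (fun z => -dy v z) z = -dy (dy v) z := by
        simp only [dy]
        rw [fderiv_fun_neg]
        rfl
      rw [h1]
      linear_combination -hz)
    (by
      filter_upwards [codazzi₂, hall] with z hz ⟨h1, h2, h3, h4⟩
      simp only [dx, dy] at hz ⊢
      rw [fderiv_mul_exp_add h2 h1 h3, fderiv_mul_exp_add h2 h1 h4]
      linear_combination (2 * Real.exp (-v z)) * hz
        + (-fderiv ℝ H z Complex.I * Real.exp (v z)) * hee z)
    (by
      filter_upwards [codazzi₁, hall] with z hz ⟨h1, h2, h3, h4⟩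
      simp only [dx, dy] at hz ⊢
      rw [fderiv_mul_exp_add h2 h1 h3, fderiv_mul_exp_add h2 h1 h4]
      linear_combination (2 * Real.exp (-v z)) * hz
        + (fderiv ℝ H z 1 * Real.exp (v z)) * hee z)
    (by
      filter_upwards [hall] with z ⟨h1, _⟩
      exact hexp _ h1)
    (by
      filter_upwards [hall] with z ⟨h1, _⟩
      rw [neg_mul, neg_neg]
      exact hexp _ h1)
  refine ⟨f, hf, hfz.mono fun z ⟨hc, h1, h2, h3⟩ => ⟨hc, h1, ?_, ?_⟩⟩
  · rw [h2]
    field_simp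
    ring
  · rw [h3]
    have := congrArg (fun x : ℝ => (x : ℂ)) (hee z)
    push_cast at this ⊢
    linear_combination (q₁ z + Complex.I * q₂ z) * this

end FundamentalTheorem

/-! ### Radial functions and the canonical Hopf differential -/

section RotationalData

theorem hasFDerivAt_radial {V : ℝ → ℝ} {V' : ℝ} {z : ℂ} (h : HasDerivAt V V' (‖z‖ ^ 2)) :
    HasFDerivAt (fun w : ℂ => V (‖w‖ ^ 2)) (V' • (2 • innerSL ℝ z)) z :=
  h.comp_hasFDerivAt z (hasStrictFDerivAt_norm_sq z).hasFDerivAt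

theorem dx_radial {V : ℝ → ℝ} {V' : ℝ} {z : ℂ} (h : HasDerivAt V V' (‖z‖ ^ 2)) :
    dx (fun w : ℂ => V (‖w‖ ^ 2)) z = V' * (2 * z.re) := by
  rw [dx, (hasFDerivAt_radial h).fderiv]
  simp [Complex.inner]

theorem dy_radial {V : ℝ → ℝ} {V' : ℝ} {z : ℂ} (h : HasDerivAt V V' (‖z‖ ^ 2)) :
    dy (fun w : ℂ => V (‖w‖ ^ 2)) z = V' * (2 * z.im) := by
  rw [dy, (hasFDerivAt_radial h).fderiv]
  simp [Complex.inner]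

theorem laplacian_radial {V V₁ : ℝ → ℝ} {V₂ : ℝ} {z : ℂ}
    (h : ∀ᶠ x in 𝓝 (‖z‖ ^ 2), HasDerivAt V (V₁ x) x) (h' : HasDerivAt V₁ V₂ (‖z‖ ^ 2)) :
    dx (dx fun w : ℂ => V (‖w‖ ^ 2)) z + dy (dy fun w : ℂ => V (‖w‖ ^ 2)) z
      = 4 * (V₁ (‖z‖ ^ 2) + ‖z‖ ^ 2 * V₂) := by
  have hc : ContinuousAt (fun w : ℂ => ‖w‖ ^ 2) z := by fun_prop
  have hx : (dx fun w : ℂ => V (‖w‖ ^ 2)) =ᶠ[𝓝 z] fun w => V₁ (‖w‖ ^ 2) * (2 * w.re) :=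
    (hc.eventually h).mono fun w hw => dx_radial hw
  have hy : (dy fun w : ℂ => V (‖w‖ ^ 2)) =ᶠ[𝓝 z] fun w => V₁ (‖w‖ ^ 2) * (2 * w.im) :=
    (hc.eventually h).mono fun w hw => dy_radial hw
  have h1 := (hasFDerivAt_radial h').mul (Complex.reCLM.hasFDerivAt (x := z) |>.const_mul 2)
  have h2 := (hasFDerivAt_radial h').mul (Complex.imCLM.hasFDerivAt (x := z) |>.const_mul 2)
  have e1 : dx (dx fun w : ℂ => V (‖w‖ ^ 2)) z = V₁ (‖z‖ ^ 2) * 2 + 2 * z.re * (V₂ * (2 * z.re)) := by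
    rw [dx, hx.fderiv_eq]
    refine (congrArg (fun L : ℂ →L[ℝ] ℝ => L 1) h1.fderiv).trans ?_
    simp [Complex.inner]
  have e2 : dy (dy fun w : ℂ => V (‖w‖ ^ 2)) z = V₁ (‖z‖ ^ 2) * 2 + 2 * z.im * (V₂ * (2 * z.im)) := by
    rw [dy, hy.fderiv_eq]
    refine (congrArg (fun L : ℂ →L[ℝ] ℝ => L Complex.I) h2.fderiv).trans ?_
    simp [Complex.inner]
  have e3 : ‖z‖ ^ 2 = z.re ^ 2 + z.im ^ 2 := by
    rw [← Complex.normSq_eq_norm_sq, Complex.normSq_apply]; ring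
  rw [e1, e2]
  rw [e3]
  ring

/-- The Hopf differentials of the members of the Bonnet family in the normalized coordinate. -/
def hopfQ (J : ℕ) (μ w : ℂ) : ℂ :=
  ((J : ℂ) + 2) * ((μ - (starRingEnd ℂ w) ^ (J + 2)) / (1 - μ * w ^ (J + 2))) *
      (w ^ J / (1 - ((‖w‖ ^ 2 : ℝ) : ℂ) ^ (J + 2)))

theorem ofReal_norm_sq (w : ℂ) : ((‖w‖ ^ 2 : ℝ) : ℂ) = w * starRingEnd ℂ w := by
  rw [Complex.mul_conj, Complex.normSq_eq_norm_sq]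

theorem one_sub_mul_pow_ne_zero {μ w : ℂ} (hμ : ‖μ‖ = 1) (hw : ‖w‖ < 1) (n : ℕ) (hn : n ≠ 0) :
    1 - μ * w ^ n ≠ 0 := by
  intro h
  have h1 : ‖μ * w ^ n‖ = 1 := by rw [← sub_eq_zero.1 h]; simp
  rw [norm_mul, hμ, one_mul, norm_pow] at h1
  exact (pow_lt_one₀ (norm_nonneg w) hw hn).ne h1

theorem one_sub_norm_sq_pow_ne_zero {w : ℂ} (hw : ‖w‖ < 1) (n : ℕ) (hn : n ≠ 0) :
    1 - ((‖w‖ ^ 2 : ℝ) : ℂ) ^ n ≠ 0 := by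
  have h := one_sub_mul_pow_ne_zero (μ := 1) (w := ((‖w‖ ^ 2 : ℝ) : ℂ)) (by simp)
    (by
      rw [Complex.norm_real, Real.norm_of_nonneg (by positivity)]
      exact pow_lt_one₀ (norm_nonneg w) hw two_ne_zero) n hn
  rwa [one_mul] at h

theorem analyticAt_hopfQ (J : ℕ) {w : ℂ} (hw : ‖w‖ < 1) : AnalyticAt ℝ (hopfQ J 1) w := by
  have hconj : AnalyticAt ℝ (fun w : ℂ => starRingEnd ℂ w) w := Complex.conjCLE.analyticAt w
  have hid : AnalyticAt ℝ (fun w : ℂ => w) w := analyticAt_id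
  have h1 := one_sub_mul_pow_ne_zero (μ := 1) (by simp) hw (J + 2) (by simp)
  have h2 := one_sub_norm_sq_pow_ne_zero hw (J + 2) (by simp)
  simp only [ofReal_norm_sq] at h2
  unfold hopfQ
  simp only [ofReal_norm_sq]
  exact (analyticAt_const.mul ((analyticAt_const.sub (hconj.pow _)).div
    (analyticAt_const.sub (analyticAt_const.mul (hid.pow _))) h1)).mul
    ((hid.pow J).div (analyticAt_const.sub ((hid.mul hconj).pow _)) h2)

/-- Only the antilinear part `∂Q/∂z̄` enters the Codazzi equation, so the linear coefficient `α` is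
left unspecified. Differentiating `(1 - z̄ ^ n) / (1 - (z z̄) ^ n)` in `z̄` produces a factor `1 - z
^ n` that cancels the holomorphic denominator. -/
theorem fderiv_hopfQ (J : ℕ) {z : ℂ} (hz : ‖z‖ < 1) : ∃ α : ℂ, ∀ u : ℂ,
    fderiv ℝ (hopfQ J 1) z u = α * u - ((J : ℂ) + 2) ^ 2 * z ^ J * (starRingEnd ℂ z) ^ (J + 1)
      / (1 - ((‖z‖ ^ 2 : ℝ) : ℂ) ^ (J + 2)) ^ 2 * starRingEnd ℂ u := by
  have h1 := one_sub_mul_pow_ne_zero (μ := 1) (by simp) hz (J + 2) (by simp)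
  have h2 := one_sub_norm_sq_pow_ne_zero hz (J + 2) (by simp)
  let F : ℂ → ℂ := fun w => ((J : ℂ) + 2) * w ^ J / (1 - 1 * w ^ (J + 2))
  have hF : DifferentiableAt ℂ F z := by
    refine DifferentiableAt.div (by fun_prop) (by fun_prop) h1
  set ζ := starRingEnd ℂ z with hζ
  have hfun : hopfQ J 1 = fun w => F w * ((1 - (starRingEnd ℂ w) ^ (J + 2)) /
      (1 - (w * starRingEnd ℂ w) ^ (J + 2))) := by
    funext w
    simp only [hopfQ, F, ofReal_norm_sq, div_eq_mul_inv]
    ring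
  rw [ofReal_norm_sq, ← hζ] at h2
  refine ⟨deriv F z * ((1 - ζ ^ (J + 2)) / (1 - (z * ζ) ^ (J + 2)))
    + F z * ((1 - ζ ^ (J + 2)) * ((J + 2 : ℕ) * (z * ζ) ^ (J + 1) * ζ)
        / (1 - (z * ζ) ^ (J + 2)) ^ 2), fun u => ?_⟩
  have hd : DifferentiableAt ℝ (hopfQ J 1) z := (analyticAt_hopfQ J hz).differentiableAt
  have hline : HasLineDerivAt ℝ (hopfQ J 1) (fderiv ℝ (hopfQ J 1) z u) z u :=
    hd.hasFDerivAt.hasLineDerivAt u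
  have hw : HasDerivAt (fun t : ℝ => z + t • u) u 0 := by
    simpa using ((hasDerivAt_id (0 : ℝ)).smul_const u).const_add z
  have hc : HasDerivAt (fun t : ℝ => starRingEnd ℂ (z + t • u)) (starRingEnd ℂ u) 0 :=
    (Complex.conjCLE : ℂ →L[ℝ] ℂ).hasFDerivAt.comp_hasDerivAt 0 hw
  have hFl : HasDerivAt (fun t : ℝ => F (z + t • u)) (deriv F z * u) 0 := by
    have h := hF.hasDerivAt.comp_of_eq (0 : ℝ) hw (by simp)
    exact h
  have hz0 : z + (0 : ℝ) • u = z := by simp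
  have hq := hFl.mul (((hasDerivAt_const (0 : ℝ) (1 : ℂ)).sub (hc.pow (J + 2))).div
    ((hasDerivAt_const (0 : ℝ) (1 : ℂ)).sub ((hw.mul hc).pow (J + 2)))
    (by simpa [hz0] using h2))
  have huniq := hline.unique (by rw [HasLineDerivAt, hfun]; exact hq)
  rw [huniq]
  simp only [Pi.mul_apply, Pi.sub_apply, Pi.pow_apply, Pi.div_apply, hz0, ← hζ, ofReal_norm_sq,
    show J + 2 - 1 = J + 1 from rfl]
  have hF0 : F z * (1 - z ^ (J + 2)) = (J + 2) * z ^ J := by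
    rw [one_mul] at h1
    simp only [F, one_mul]
    field_simp
  rw [mul_pow, mul_comm] at h2
  simp only [mul_pow]
  generalize deriv F z = F₁ at *
  generalize F z = F₀ at *
  push_cast
  field_simp
  linear_combination (-(J + 2) * ζ ^ (J + 1) * starRingEnd ℂ u) * hF0

end RotationalData

/-! ### Existence of the surface -/

section Existence

/-- The quotient `(1 - z̄ ^ n) / (1 - z ^ n)` is unimodular, so `|Q|` is radial, as the Gauss
equation with radial `H` and metric requires. -/
theorem norm_hopfQ_sq (J : ℕ) {z : ℂ} (hz : ‖z‖ < 1) :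
    (hopfQ J 1 z).re ^ 2 + (hopfQ J 1 z).im ^ 2
      = ((J : ℝ) + 2) ^ 2 * (‖z‖ ^ 2) ^ J / (1 - (‖z‖ ^ 2) ^ (J + 2)) ^ 2 := by
  have h1 := one_sub_mul_pow_ne_zero (μ := 1) (by simp) hz (J + 2) (by simp)
  rw [one_mul] at h1
  have e1 : ‖1 - (starRingEnd ℂ z) ^ (J + 2)‖ = ‖1 - z ^ (J + 2)‖ := by
    rw [← Complex.norm_conj]
    simp
  have e2 : ‖1 - ((‖z‖ ^ 2 : ℝ) : ℂ) ^ (J + 2)‖ ^ 2 = (1 - (‖z‖ ^ 2) ^ (J + 2)) ^ 2 := by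
    rw [← Complex.ofReal_pow, ← Complex.ofReal_one, ← Complex.ofReal_sub, Complex.norm_real,
      Real.norm_eq_abs, sq_abs]
  have e3 : ‖(J : ℂ) + 2‖ = (J : ℝ) + 2 := by
    rw [show (J : ℂ) + 2 = ((J + 2 : ℝ) : ℂ) by push_cast; rfl, Complex.norm_real,
      Real.norm_of_nonneg (by positivity)]
  have e0 : (hopfQ J 1 z).re ^ 2 + (hopfQ J 1 z).im ^ 2 = ‖hopfQ J 1 z‖ ^ 2 := by
    rw [← Complex.normSq_eq_norm_sq, Complex.normSq_apply]; ring
  rw [e0, hopfQ, norm_mul, norm_mul, norm_div, norm_div, one_mul, e1,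
    div_self (norm_ne_zero_iff.2 h1), mul_one, e3, norm_pow, mul_pow, div_pow, e2]
  ring

/-- These are twice the real and imaginary parts of `∂Q/∂z̄ = -β z̄` with `β` radial, the shape of
`∂H/∂z = h' z̄` for a radial `H`. -/
theorem hopfQ_codazzi (J : ℕ) {z : ℂ} (hz : ‖z‖ < 1) :
    dx (fun w => (hopfQ J 1 w).re) z - dy (fun w => (hopfQ J 1 w).im) z
      = -(2 * ((J : ℝ) + 2) ^ 2 * (‖z‖ ^ 2) ^ J / (1 - (‖z‖ ^ 2) ^ (J + 2)) ^ 2 * z.re) ∧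
    dy (fun w => (hopfQ J 1 w).re) z + dx (fun w => (hopfQ J 1 w).im) z
      = 2 * ((J : ℝ) + 2) ^ 2 * (‖z‖ ^ 2) ^ J / (1 - (‖z‖ ^ 2) ^ (J + 2)) ^ 2 * z.im := by
  obtain ⟨α, hα⟩ := fderiv_hopfQ J hz
  have hd : HasFDerivAt (hopfQ J 1) _ z := (analyticAt_hopfQ J hz).differentiableAt.hasFDerivAt
  have hre : ∀ u, fderiv ℝ (fun w => (hopfQ J 1 w).re) z u = (fderiv ℝ (hopfQ J 1) z u).re :=
    fun u => congrArg (fun L : ℂ →L[ℝ] ℝ => L u) (Complex.reCLM.hasFDerivAt.comp z hd).fderiv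
  have him : ∀ u, fderiv ℝ (fun w => (hopfQ J 1 w).im) z u = (fderiv ℝ (hopfQ J 1) z u).im :=
    fun u => congrArg (fun L : ℂ →L[ℝ] ℝ => L u) (Complex.imCLM.hasFDerivAt.comp z hd).fderiv
  set β : ℝ := ((J : ℝ) + 2) ^ 2 * (‖z‖ ^ 2) ^ J / (1 - (‖z‖ ^ 2) ^ (J + 2)) ^ 2 with hβ
  have hcoef : ((J : ℂ) + 2) ^ 2 * z ^ J * (starRingEnd ℂ z) ^ (J + 1)
      / (1 - ((‖z‖ ^ 2 : ℝ) : ℂ) ^ (J + 2)) ^ 2 = (β : ℂ) * starRingEnd ℂ z := by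
    have : (β : ℂ) = ((J : ℂ) + 2) ^ 2 * ((‖z‖ ^ 2 : ℝ) : ℂ) ^ J
        / (1 - ((‖z‖ ^ 2 : ℝ) : ℂ) ^ (J + 2)) ^ 2 := by
      rw [hβ]; push_cast; rfl
    rw [this, show ((‖z‖ ^ 2 : ℝ) : ℂ) ^ J = (z * starRingEnd ℂ z) ^ J by rw [ofReal_norm_sq]]
    rw [mul_pow]
    ring
  simp only [dx, dy, hre, him, hα, hcoef]
  have h2 : 2 * ((J : ℝ) + 2) ^ 2 * (‖z‖ ^ 2) ^ J / (1 - (‖z‖ ^ 2) ^ (J + 2)) ^ 2 = 2 * β := by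
    rw [hβ]; ring
  rw [h2]
  constructor
  · simp
    ring
  · simp
    ring

/-- Codazzi determines the conformal factor as `2 n² / ((1 - s ^ n)² (-G))`; inserting it in the
Gauss equation leaves exactly the equation solved by `g`. -/
theorem exists_surface (J : ℕ) (h₀ G₀ : ℝ) (hG₀ : G₀ < 0) :
    ∃ (B g : ℝ → ℝ) (f : ℂ → E3), AnalyticAt ℝ B 0 ∧ AnalyticAt ℝ g 0 ∧ AnalyticAt ℝ f 0 ∧
      g 0 = 0 ∧ B 0 = G₀ / (J + 1) ∧
      (∀ᶠ x in 𝓝 0, HasDerivAt (fun x => h₀ + x ^ (J + 1) * B x)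
        (x ^ J * (G₀ * Real.exp (g x))) x ∧
        HasDerivAt (fun x => x * deriv g x) (x ^ J * (G₀ * Real.exp (g x))
          + ((J : ℝ) + 2) ^ 2 / (1 - x ^ (J + 2)) ^ 2 * (2 * x ^ (J + 1)
            - (h₀ + x ^ (J + 1) * B x) ^ 2 / (G₀ * Real.exp (g x)))) x) ∧
      ∀ᶠ z in 𝓝 (0 : ℂ), (dx f z ≠ 0 ∧ ‖dx f z‖ = ‖dy f z‖ ∧ inner ℝ (dx f z) (dy f z) = 0) ∧
        metricCoeff f z = 2 * ((J : ℝ) + 2) ^ 2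
          / ((1 - (‖z‖ ^ 2) ^ (J + 2)) ^ 2 * -(G₀ * Real.exp (g (‖z‖ ^ 2)))) ∧
        meanCurvature f z = h₀ + (‖z‖ ^ 2) ^ (J + 1) * B (‖z‖ ^ 2) ∧
        hopf f z = hopfQ J 1 z := by
  obtain ⟨B, g, P, hB, hg, hP, hg0, hB0, hode⟩ := exists_analyticAt_hazzidakis J h₀ G₀ hG₀.ne
  -- Half the logarithm of the conformal factor, since the metric is `exp (2 v)`; `V₁` is its
  -- derivative.
  let V : ℝ → ℝ := fun x => Real.log (2 * ((J : ℝ) + 2) ^ 2 / -G₀) / 2 - Real.log (1 - x ^ (J + 2))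
    - g x / 2
  let V₁ : ℝ → ℝ := fun x => ((J : ℝ) + 2) * x ^ (J + 1) / (1 - x ^ (J + 2)) - P x / 2
  have hone : ∀ᶠ x in 𝓝 (0 : ℝ), 0 < 1 - x ^ (J + 2) := by
    have hc : ContinuousAt (fun x : ℝ => 1 - x ^ (J + 2)) 0 := by fun_prop
    exact hc.eventually (lt_mem_nhds (by simp))
  have hV : AnalyticAt ℝ V 0 := by
    have h1 : AnalyticAt ℝ (fun x : ℝ => 1 - x ^ (J + 2)) 0 :=
      analyticAt_const.sub (analyticAt_id.pow _)
    exact (analyticAt_const.sub (h1.log (by simp))).sub hg.div_const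
  have hV' : ∀ᶠ x in 𝓝 0, HasDerivAt V (V₁ x) x := by
    filter_upwards [hode, hone] with x ⟨_, h2, _⟩ hx
    have h3 : HasDerivAt (fun x : ℝ => 1 - x ^ (J + 2)) (-((J + 2 : ℕ) * x ^ (J + 1))) x := by
      simpa using ((hasDerivAt_id x).pow (J + 2)).const_sub 1
    have h4 := ((h3.log hx.ne').const_sub (Real.log (2 * ((J : ℝ) + 2) ^ 2 / -G₀) / 2)).sub
      (h2.div_const 2)
    refine h4.congr_deriv ?_
    simp only [V₁]
    push_cast
    ring
  -- `V₁ + x V₂ = (x V₁)'` is a quarter of the Laplacian of the radial function; the term `(x P)'`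
  -- is then replaced by means of the differential equation.
  have hlap : ∀ᶠ x in 𝓝 0, ∃ V₂, HasDerivAt V₁ V₂ x ∧
      V₁ x + x * V₂ = ((J : ℝ) + 2) ^ 2 * x ^ (J + 1) / (1 - x ^ (J + 2)) ^ 2
        - (x ^ J * (G₀ * Real.exp (g x))
          + ((J : ℝ) + 2) ^ 2 / (1 - x ^ (J + 2)) ^ 2 * (2 * x ^ (J + 1)
            - (h₀ + x ^ (J + 1) * B x) ^ 2 / (G₀ * Real.exp (g x)))) / 2 := by
    filter_upwards [hode, hone, hP.eventually_analyticAt] with x ⟨_, _, h3⟩ hx hPx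
    have h4 := hPx.differentiableAt.hasDerivAt
    have h5 := ((hasDerivAt_id x).mul h4).unique h3
    have h6 : HasDerivAt (fun x : ℝ => 1 - x ^ (J + 2)) (-((J + 2 : ℕ) * x ^ (J + 1))) x := by
      simpa using ((hasDerivAt_id x).pow (J + 2)).const_sub 1
    have h7 : HasDerivAt (fun x : ℝ => ((J : ℝ) + 2) * x ^ (J + 1))
        (((J : ℝ) + 2) * ((J + 1 : ℕ) * x ^ J)) x := by
      simpa using ((hasDerivAt_id x).pow (J + 1)).const_mul ((J : ℝ) + 2)
    refine ⟨_, (h7.div h6 hx.ne').sub (h4.div_const 2), ?_⟩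
    rw [← h5]
    have hx' := hx.ne'
    simp only [V₁, id]
    push_cast
    field_simp
    ring
  have hexpV : ∀ᶠ x in 𝓝 0, Real.exp (V x) ^ 2
      = 2 * ((J : ℝ) + 2) ^ 2 / ((1 - x ^ (J + 2)) ^ 2 * -(G₀ * Real.exp (g x))) := by
    filter_upwards [hone] with x hx
    have hpos : 0 < 2 * ((J : ℝ) + 2) ^ 2 / -G₀ := div_pos (by positivity) (neg_pos.2 hG₀)
    rw [← Real.exp_nat_mul]
    have : ((2 : ℕ) : ℝ) * V x = Real.log (2 * ((J : ℝ) + 2) ^ 2 / -G₀)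
        - (2 : ℕ) * Real.log (1 - x ^ (J + 2)) - g x := by
      simp only [V]; push_cast; ring
    rw [this, Real.exp_sub, Real.exp_sub, Real.exp_log hpos, Real.exp_nat_mul, Real.exp_log hx]
    have := hG₀.ne
    field_simp
  have hsq : Tendsto (fun z : ℂ => ‖z‖ ^ 2) (𝓝 0) (𝓝 0) := by
    have : Continuous fun z : ℂ => ‖z‖ ^ 2 := by fun_prop
    simpa using this.tendsto 0
  have hball : ∀ᶠ z in 𝓝 (0 : ℂ), ‖z‖ < 1 := by
    have : Tendsto (fun z : ℂ => ‖z‖) (𝓝 0) (𝓝 0) := by simpa using (continuous_norm (E := ℂ)).tendsto 0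
    exact this.eventually (gt_mem_nhds one_pos)
  have hsqan : AnalyticAt ℝ (fun z : ℂ => ‖z‖ ^ 2) 0 := by
    have h1 : (fun z : ℂ => ‖z‖ ^ 2) = fun z => z.re * z.re + z.im * z.im := by
      funext z; rw [← Complex.normSq_eq_norm_sq, Complex.normSq_apply]
    rw [h1]
    exact ((Complex.reCLM.analyticAt 0).mul (Complex.reCLM.analyticAt 0)).add
      ((Complex.imCLM.analyticAt 0).mul (Complex.imCLM.analyticAt 0))
  have hrad : ∀ {F : ℝ → ℝ}, AnalyticAt ℝ F 0 → AnalyticAt ℝ (fun z : ℂ => F (‖z‖ ^ 2)) 0 :=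
    fun hF => hF.comp_of_eq hsqan (by simp)
  have hH : AnalyticAt ℝ (fun x => h₀ + x ^ (J + 1) * B x) 0 :=
    analyticAt_const.add ((analyticAt_id.pow _).mul hB)
  have hQ := analyticAt_hopfQ J (w := 0) (by simp)
  obtain ⟨f, hf, hfz⟩ := exists_analyticAt_of_gauss_codazzi (hrad hV) (hrad hH)
    ((Complex.reCLM.analyticAt _).comp hQ) ((Complex.imCLM.analyticAt _).comp hQ)
    (by
      filter_upwards [hsq.eventually hV'.eventually_nhds, hsq.eventually hlap,
        hsq.eventually hexpV, hsq.eventually hone, hball] with z h1 ⟨V₂, h2, h3⟩ h4 h5 h6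
      have h7 : Real.exp (-V (‖z‖ ^ 2)) ^ 2 = (Real.exp (V (‖z‖ ^ 2)) ^ 2)⁻¹ := by
        rw [Real.exp_neg, inv_pow]
      have h8 := norm_hopfQ_sq J h6
      rw [laplacian_radial h1 h2, h3, h7, h4]
      change _ - 4 * ((hopfQ J 1 z).re ^ 2 + (hopfQ J 1 z).im ^ 2) * _ = 0
      rw [h8]
      have h9 := hG₀.ne
      have h10 := h5.ne'
      have h11 : (J : ℝ) + 2 ≠ 0 := by positivity
      field_simp
      ring)
    (by
      filter_upwards [hsq.eventually hode, hsq.eventually hexpV, hsq.eventually hone, hball]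
        with z ⟨h1, _, _⟩ h4 h5 h6
      refine (hopfQ_codazzi J h6).1.trans ?_
      rw [dx_radial h1, h4]
      have h9 := hG₀.ne
      have h10 := h5.ne'
      field_simp)
    (by
      filter_upwards [hsq.eventually hode, hsq.eventually hexpV, hsq.eventually hone, hball]
        with z ⟨h1, _, _⟩ h4 h5 h6
      refine (hopfQ_codazzi J h6).2.trans ?_
      rw [dy_radial h1, h4]
      have h9 := hG₀.ne
      have h10 := h5.ne'
      field_simp)
  refine ⟨B, g, f, hB, hg, hf, hg0, hB0, ?_, ?_⟩
  · have hPg : ∀ᶠ x in 𝓝 0, deriv g x = P x := hode.mono fun x h => h.2.1.deriv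
    filter_upwards [hode, hPg.eventually_nhds] with x ⟨h1, h2, h3⟩ h4
    exact ⟨h1, h3.congr_of_eventuallyEq (h4.mono fun y hy => by simp [hy])⟩
  · filter_upwards [hfz, hsq.eventually hexpV] with z ⟨h1, h2, h3, h4⟩ h5
    refine ⟨h1, h2.trans h5, h3, h4.trans ?_⟩
    simp only [Function.comp_apply, Complex.reCLM_apply, Complex.imCLM_apply]
    rw [mul_comm, Complex.re_add_im]

end Existence

/-! ### Rotating the parameter -/

section Rotation

variable {E : Type*} [NormedAddCommGroup E] [NormedSpace ℝ E]

theorem hasFDerivAt_comp_mul {f : ℂ → E} {c z : ℂ} (hf : DifferentiableAt ℝ f (c * z)) :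
    ∃ L : ℂ →L[ℝ] E, HasFDerivAt (fun w => f (c * w)) L z ∧
      ∀ u, L u = (c * u).re • dx f (c * z) + (c * u).im • dy f (c * z) := by
  have h : HasFDerivAt (fun w : ℂ => c * w) (ContinuousLinearMap.mul ℝ ℂ c) z :=
    (ContinuousLinearMap.mul ℝ ℂ c).hasFDerivAt
  refine ⟨_, HasFDerivAt.comp (g := f) z hf.hasFDerivAt h, fun u => ?_⟩
  rw [← fderiv_eq_dx_dy]
  rfl

theorem dx_comp_mul {f : ℂ → E} {c z : ℂ} (hf : DifferentiableAt ℝ f (c * z)) :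
    dx (fun w => f (c * w)) z = c.re • dx f (c * z) + c.im • dy f (c * z) := by
  obtain ⟨L, hL, h⟩ := hasFDerivAt_comp_mul hf
  rw [dx, hL.fderiv, h, mul_one]

theorem dy_comp_mul {f : ℂ → E} {c z : ℂ} (hf : DifferentiableAt ℝ f (c * z)) :
    dy (fun w => f (c * w)) z = (-c.im) • dx f (c * z) + c.re • dy f (c * z) := by
  obtain ⟨L, hL, h⟩ := hasFDerivAt_comp_mul hf
  rw [dy, hL.fderiv, h]
  simp

theorem dx_dy_comm [CompleteSpace E] {f : ℂ → E} {z : ℂ} (hf : AnalyticAt ℝ f z) :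
    dy (dx f) z = dx (dy f) z := by
  have hsymm : IsSymmSndFDerivAt ℝ f z :=
    (hf.contDiffAt (n := ω)).isSymmSndFDerivAt (by simp)
  have hd := hf.fderiv.differentiableAt.hasFDerivAt
  have h : ∀ u v, fderiv ℝ (fun w => fderiv ℝ f w u) z v = fderiv ℝ (fderiv ℝ f) z v u := by
    intro u v
    exact congrArg (fun L : ℂ →L[ℝ] E => L v)
      ((ContinuousLinearMap.apply ℝ E u).hasFDerivAt.comp z hd).fderiv
  change fderiv ℝ (fun w => fderiv ℝ f w 1) z Complex.I
    = fderiv ℝ (fun w => fderiv ℝ f w Complex.I) z 1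
  rw [h, h]
  exact hsymm _ _

variable {f : ℂ → E3} {c z : ℂ}

theorem re_sq_add_im_sq (hc : ‖c‖ = 1) : c.re ^ 2 + c.im ^ 2 = 1 := by
  rw [← one_pow (M := ℝ) 2, ← hc, ← Complex.normSq_eq_norm_sq, Complex.normSq_apply]; ring

theorem conformal_comp_mul (hc : ‖c‖ = 1) (hf : DifferentiableAt ℝ f (c * z))
    (h0 : dx f (c * z) ≠ 0) (h1 : ‖dx f (c * z)‖ = ‖dy f (c * z)‖)
    (h2 : inner ℝ (dx f (c * z)) (dy f (c * z)) = 0) :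
    dx (fun w => f (c * w)) z ≠ 0 ∧
      ‖dx (fun w => f (c * w)) z‖ = ‖dy (fun w => f (c * w)) z‖ ∧
      inner ℝ (dx (fun w => f (c * w)) z) (dy (fun w => f (c * w)) z) = 0 ∧
      metricCoeff (fun w => f (c * w)) z = metricCoeff f (c * z) := by
  have hab := re_sq_add_im_sq hc
  have h1' : ‖dy f (c * z)‖ ^ 2 = ‖dx f (c * z)‖ ^ 2 := by rw [h1]
  have e1 : ‖dx (fun w => f (c * w)) z‖ ^ 2 = ‖dx f (c * z)‖ ^ 2 := by
    rw [dx_comp_mul hf, norm_add_sq_real, norm_smul, norm_smul, mul_pow, mul_pow, inner_smul_left,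
      inner_smul_right, h2, Real.norm_eq_abs, Real.norm_eq_abs, sq_abs, sq_abs, h1']
    linear_combination ‖dx f (c * z)‖ ^ 2 * hab
  have e2 : ‖dy (fun w => f (c * w)) z‖ ^ 2 = ‖dx f (c * z)‖ ^ 2 := by
    rw [dy_comp_mul hf, norm_add_sq_real, norm_smul, norm_smul, mul_pow, mul_pow, inner_smul_left,
      inner_smul_right, h2, Real.norm_eq_abs, Real.norm_eq_abs, sq_abs, sq_abs, h1']
    linear_combination ‖dx f (c * z)‖ ^ 2 * hab
  refine ⟨fun h => h0 ?_, ?_, ?_, ?_⟩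
  · rw [h] at e1
    simpa using e1.symm
  · exact (pow_left_inj₀ (norm_nonneg _) (norm_nonneg _) two_ne_zero).1 (e1.trans e2.symm)
  · rw [dx_comp_mul hf, dy_comp_mul hf]
    simp only [inner_add_left, inner_add_right, inner_smul_left, inner_smul_right,
      real_inner_self_eq_norm_sq, h1', real_inner_comm (dx f (c * z)) (dy f (c * z)), h2]
    simp
    ring
  · rw [metricCoeff, metricCoeff, e1, e2, h1']

/-- A rotation of the parameter plane has determinant `1`, so the cross product of the two partial
derivatives does not change. -/
theorem unitNormal_comp_mul (hc : ‖c‖ = 1) (hf : DifferentiableAt ℝ f (c * z)) :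
    unitNormal (fun w => f (c * w)) z = unitNormal f (c * z) := by
  have hab := re_sq_add_im_sq hc
  have : cross (dx (fun w => f (c * w)) z) (dy (fun w => f (c * w)) z)
      = cross (dx f (c * z)) (dy f (c * z)) := by
    rw [dx_comp_mul hf, dy_comp_mul hf]
    ext i
    fin_cases i <;> simp [cross, crossProduct]
    · linear_combination (dx f (c * z) 1 * dy f (c * z) 2 - dx f (c * z) 2 * dy f (c * z) 1) * hab
    · linear_combination (dx f (c * z) 2 * dy f (c * z) 0 - dx f (c * z) 0 * dy f (c * z) 2) * hab
    · linear_combination (dx f (c * z) 0 * dy f (c * z) 1 - dx f (c * z) 1 * dy f (c * z) 0) * hab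
  rw [unitNormal, unitNormal, this]

theorem second_derivatives_comp_mul (hf : AnalyticAt ℝ f (c * z)) :
    dx (dx fun w => f (c * w)) z = c.re ^ 2 • dx (dx f) (c * z)
      + (2 * c.re * c.im) • dx (dy f) (c * z) + c.im ^ 2 • dy (dy f) (c * z) ∧
    dy (dy fun w => f (c * w)) z = c.im ^ 2 • dx (dx f) (c * z)
      - (2 * c.re * c.im) • dx (dy f) (c * z) + c.re ^ 2 • dy (dy f) (c * z) ∧
    dx (dy fun w => f (c * w)) z = (c.re * c.im) • (dy (dy f) (c * z) - dx (dx f) (c * z))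
      + (c.re ^ 2 - c.im ^ 2) • dx (dy f) (c * z) := by
  have hsymm := dx_dy_comm hf
  have hcont : ContinuousAt (fun w : ℂ => c * w) z := by fun_prop
  have hev : ∀ᶠ w in 𝓝 z, DifferentiableAt ℝ f (c * w) :=
    (hcont.eventually hf.eventually_analyticAt).mono fun w h => h.differentiableAt
  have hdx : DifferentiableAt ℝ (dx f) (c * z) := (analyticAt_fderiv_apply hf 1).differentiableAt
  have hdy : DifferentiableAt ℝ (dy f) (c * z) :=
    (analyticAt_fderiv_apply hf Complex.I).differentiableAt
  have e1 : dx (fun w => f (c * w)) =ᶠ[𝓝 z]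
      fun w => c.re • dx f (c * w) + c.im • dy f (c * w) := hev.mono fun w h => dx_comp_mul h
  have e2 : dy (fun w => f (c * w)) =ᶠ[𝓝 z]
      fun w => (-c.im) • dx f (c * w) + c.re • dy f (c * w) := hev.mono fun w h => dy_comp_mul h
  obtain ⟨L₁, hL₁, h₁⟩ := hasFDerivAt_comp_mul hdx
  obtain ⟨L₂, hL₂, h₂⟩ := hasFDerivAt_comp_mul hdy
  have d : ∀ (s t : ℝ) (u : ℂ),
      fderiv ℝ (fun w => s • dx f (c * w) + t • dy f (c * w)) z u = s • L₁ u + t • L₂ u :=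
    fun s t u => congrArg (fun L : ℂ →L[ℝ] E3 => L u)
      ((hL₁.const_smul s).add (hL₂.const_smul t)).fderiv
  refine ⟨?_, ?_, ?_⟩
  · rw [dx, e1.fderiv_eq, d, h₁, h₂, mul_one, hsymm]
    module
  · rw [dy, e2.fderiv_eq, d, h₁, h₂, hsymm]
    simp only [Complex.mul_re, Complex.mul_im, Complex.I_re, Complex.I_im]
    module
  · rw [dx, e2.fderiv_eq, d, h₁, h₂, mul_one, hsymm]
    module

/-- The trace of the second derivatives is rotation invariant, while `F_zz` picks up `c²`, as a
quadratic differential must. -/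
theorem curvature_comp_mul (hc : ‖c‖ = 1) (hf : AnalyticAt ℝ f (c * z))
    (h0 : dx f (c * z) ≠ 0) (h1 : ‖dx f (c * z)‖ = ‖dy f (c * z)‖)
    (h2 : inner ℝ (dx f (c * z)) (dy f (c * z)) = 0) :
    meanCurvature (fun w => f (c * w)) z = meanCurvature f (c * z) ∧
      hopf (fun w => f (c * w)) z = c ^ 2 * hopf f (c * z) := by
  obtain ⟨d1, d2, d3⟩ := second_derivatives_comp_mul hf
  have hab := re_sq_add_im_sq hc
  constructor
  · rw [meanCurvature, meanCurvature, unitNormal_comp_mul hc hf.differentiableAt,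
      (conformal_comp_mul hc hf.differentiableAt h0 h1 h2).2.2.2, d1, d2]
    congr 2
    linear_combination (norm := module) hab • (dx (dx f) (c * z) + dy (dy f) (c * z))
  · rw [hopf, hopf, unitNormal_comp_mul hc hf.differentiableAt, d1, d2, d3]
    simp only [inner_add_left, inner_sub_left, inner_smul_left, conj_trivial]
    have hcc : c = c.re + c.im * Complex.I := (Complex.re_add_im c).symm
    rw [show c ^ 2 = (c.re + c.im * Complex.I) ^ 2 by rw [← hcc]]
    push_cast
    ring_nf
    simp only [Complex.I_sq, show Complex.I ^ 3 = -Complex.I by rw [pow_succ, Complex.I_sq]; ring]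
    ring

end Rotation

/-! ### Ambient isometries -/

section Congruence

/-- Lagrange's identity for `x` and `a × b`, with the double cross product `x × (a × b)` expanded.
If `x` is orthogonal to `a` and `b`, the last term vanishes. -/
theorem cross_lagrange (a b x : E3) :
    inner ℝ x (cross a b) ^ 2 = ‖x‖ ^ 2 * ‖cross a b‖ ^ 2
      - ‖inner ℝ x b • a - inner ℝ x a • b‖ ^ 2 := by
  simp only [← real_inner_self_eq_norm_sq, PiLp.inner_apply, Fin.sum_univ_three]
  simp [cross, crossProduct]
  ring

theorem norm_cross_sq (a b : E3) :
    ‖cross a b‖ ^ 2 = ‖a‖ ^ 2 * ‖b‖ ^ 2 - inner ℝ a b ^ 2 := by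
  simp only [← real_inner_self_eq_norm_sq, PiLp.inner_apply, Fin.sum_univ_three]
  simp [cross, crossProduct]
  ring

theorem inner_cross_left (a b : E3) : inner ℝ (cross a b) a = 0 := by
  simp only [PiLp.inner_apply, Fin.sum_univ_three]
  simp [cross, crossProduct]
  ring

theorem inner_cross_right (a b : E3) : inner ℝ (cross a b) b = 0 := by
  simp only [PiLp.inner_apply, Fin.sum_univ_three]
  simp [cross, crossProduct]
  ring

/-- A unit vector orthogonal to two independent vectors is their unit normal, up to sign. -/
theorem eq_or_eq_neg_of_orthogonal {a b x : E3} (ha : a ≠ 0) (hab : ‖a‖ = ‖b‖)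
    (h : inner ℝ a b = 0) (hx : ‖x‖ = 1) (hxa : inner ℝ x a = 0) (hxb : inner ℝ x b = 0) :
    x = ‖cross a b‖⁻¹ • cross a b ∨ x = -(‖cross a b‖⁻¹ • cross a b) := by
  have hpos : 0 < ‖cross a b‖ := by
    have h1 := norm_cross_sq a b
    rw [h, ← hab] at h1
    have h2 : 0 < ‖a‖ := norm_pos_iff.2 ha
    refine norm_pos_iff.2 fun h0 => ?_
    rw [h0] at h1
    simp at h1
    exact ha h1
  set m := ‖cross a b‖⁻¹ • cross a b with hm
  have hm1 : ‖m‖ = 1 := by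
    rw [hm, norm_smul, norm_inv, norm_norm, inv_mul_cancel₀ hpos.ne']
  have hin : inner ℝ x m ^ 2 = 1 := by
    rw [hm, inner_smul_right, mul_pow, cross_lagrange, hxa, hxb, hx]
    simp
    field_simp
  rcases mul_self_eq_one_iff.1 ((sq (inner ℝ x m)).symm.trans hin) with h1 | h1
  · exact Or.inl ((inner_eq_one_iff_of_norm_eq_one hx hm1).1 h1)
  · right
    have h2 : inner ℝ x (-m) = 1 := by rw [inner_neg_right, h1, neg_neg]
    exact (inner_eq_one_iff_of_norm_eq_one hx (by rwa [norm_neg])).1 h2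

theorem unitNormal_spec {f : ℂ → E3} {z : ℂ} (h0 : dx f z ≠ 0) (h1 : ‖dx f z‖ = ‖dy f z‖)
    (h2 : inner ℝ (dx f z) (dy f z) = 0) :
    ‖unitNormal f z‖ = 1 ∧ inner ℝ (unitNormal f z) (dx f z) = 0 ∧
      inner ℝ (unitNormal f z) (dy f z) = 0 := by
  have hne : ‖cross (dx f z) (dy f z)‖ ≠ 0 := by
    have h3 := norm_cross_sq (dx f z) (dy f z)
    rw [h2, ← h1] at h3
    intro h4
    rw [h4] at h3
    simp at h3
    exact h0 h3
  refine ⟨?_, ?_, ?_⟩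
  · rw [unitNormal, norm_smul, norm_inv, norm_norm, inv_mul_cancel₀ hne]
  · rw [unitNormal, inner_smul_left, inner_cross_left, mul_zero]
  · rw [unitNormal, inner_smul_left, inner_cross_right, mul_zero]

/-- Isometries of the ambient space preserve the mean curvature and the Hopf differential, up to a
common sign. -/
theorem curvature_of_isometry {U : Set ℂ} (hU : IsOpen U) {f f' : ℂ → E3} (g : E3 ≃ᵢ E3)
    (hg : ∀ z ∈ U, f' z = g (f z)) (hf : AnalyticOnNhd ℝ f U) {z : ℂ} (hz : z ∈ U)
    (h0 : dx f z ≠ 0) (h1 : ‖dx f z‖ = ‖dy f z‖) (h2 : inner ℝ (dx f z) (dy f z) = 0) :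
    ∃ ε : ℝ, (ε = 1 ∨ ε = -1) ∧ meanCurvature f' z = ε * meanCurvature f z ∧
      hopf f' z = ε * hopf f z := by
  -- By the Mazur–Ulam theorem `g` is affine, so its linear part `L` acts on all derivatives.
  set A := g.toRealAffineIsometryEquiv
  set L : E3 ≃ₗᵢ[ℝ] E3 := A.linearIsometryEquiv
  have hgA : ∀ x, g x = L x + g 0 := fun x => by
    have h := A.map_vadd 0 x
    simp only [vadd_eq_add, add_zero] at h
    exact h
  have hd : ∀ {e e' : ℂ → E3} {b : E3} {w : ℂ}, DifferentiableAt ℝ e w →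
      (∀ᶠ y in 𝓝 w, e' y = L (e y) + b) → dx e' w = L (dx e w) ∧ dy e' w = L (dy e w) := by
    intro e e' b w he hee
    have h := (((L : E3 →L[ℝ] E3).hasFDerivAt.comp w he.hasFDerivAt).add_const
      b).congr_of_eventuallyEq (f₁ := e') hee
    rw [dx, dy, h.fderiv]
    exact ⟨rfl, rfl⟩
  have h₁ : ∀ w ∈ U, dx f' w = L (dx f w) ∧ dy f' w = L (dy f w) := fun w hw =>
    hd (hf w hw).differentiableAt ((hU.mem_nhds hw) |> fun h => by
      filter_upwards [h] with y hy
      rw [hg y hy, hgA])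
  have hx : ∀ᶠ w in 𝓝 z, dx f' w = L (dx f w) + 0 := by
    filter_upwards [hU.mem_nhds hz] with w hw
    rw [(h₁ w hw).1, add_zero]
  have hy : ∀ᶠ w in 𝓝 z, dy f' w = L (dy f w) + 0 := by
    filter_upwards [hU.mem_nhds hz] with w hw
    rw [(h₁ w hw).2, add_zero]
  have hdx : DifferentiableAt ℝ (dx f) z := (analyticAt_fderiv_apply (hf z hz) 1).differentiableAt
  have hdy : DifferentiableAt ℝ (dy f) z :=
    (analyticAt_fderiv_apply (hf z hz) Complex.I).differentiableAt
  have hxx := (hd hdx hx).1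
  have hxy := (hd hdy hy).1
  have hyy := (hd hdy hy).2
  obtain ⟨hx', hy'⟩ := h₁ z hz
  have hL0 : dx f' z ≠ 0 := by rw [hx']; simpa using h0
  have hL1 : ‖dx f' z‖ = ‖dy f' z‖ := by rw [hx', hy', L.norm_map, L.norm_map, h1]
  have hL2 : inner ℝ (dx f' z) (dy f' z) = 0 := by rw [hx', hy', L.inner_map_map, h2]
  obtain ⟨n1, n2, n3⟩ := unitNormal_spec hL0 hL1 hL2
  have hmetric : metricCoeff f' z = metricCoeff f z := by
    rw [metricCoeff, metricCoeff, hx', hy', L.norm_map, L.norm_map]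
  have hinner : ∀ x, inner ℝ (L x) (unitNormal f' z) = inner ℝ x (L.symm (unitNormal f' z)) :=
    fun x => by
      have h := L.inner_map_map x (L.symm (unitNormal f' z))
      rwa [L.apply_symm_apply] at h
  -- Pulled back by `L`, the new normal is a unit vector orthogonal to the old tangent plane, hence
  -- `± N`; orientation-reversing isometries are thus covered.
  have key : ∃ ε : ℝ, (ε = 1 ∨ ε = -1) ∧ L.symm (unitNormal f' z) = ε • unitNormal f z := by
    rcases eq_or_eq_neg_of_orthogonal (x := L.symm (unitNormal f' z)) h0 h1 h2
      (by rw [L.symm.norm_map, n1])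
      (by rw [real_inner_comm, ← hinner, ← hx', real_inner_comm, n2])
      (by rw [real_inner_comm, ← hinner, ← hy', real_inner_comm, n3]) with h | h
    · exact ⟨1, Or.inl rfl, by rw [h, one_smul]; rfl⟩
    · exact ⟨-1, Or.inr rfl, by rw [h, neg_one_smul]; rfl⟩
  obtain ⟨ε, hε, hN⟩ := key
  refine ⟨ε, hε, ?_, ?_⟩
  · rw [meanCurvature, meanCurvature, hmetric, hxx, hyy, ← map_add, hinner, hN, inner_smul_right]
    ring
  · rw [hopf, hopf, hxx, hyy, hxy, ← map_sub, hinner, hinner, hN, inner_smul_right,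
      inner_smul_right]
    push_cast
    ring

end Congruence

/-! ### The deformation of the Hopf differential -/

section BonnetFamily

/-- As a function of `μ`, `(μ - w̄ ^ n) / (1 - μ w ^ n)` is a Möbius map of determinant `1 - |w| ^
(2 n) ≠ 0`. The point `w = 0` is excluded because of the factor `w ^ J`. -/
theorem hopfQ_injective (J : ℕ) {μ μ' w : ℂ} (hμ : ‖μ‖ = 1) (hμ' : ‖μ'‖ = 1) (hw0 : w ≠ 0)
    (hw : ‖w‖ < 1) (h : hopfQ J μ w = hopfQ J μ' w) : μ = μ' := by
  have h1 := one_sub_mul_pow_ne_zero hμ hw (J + 2) (by simp)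
  have h2 := one_sub_mul_pow_ne_zero hμ' hw (J + 2) (by simp)
  have h3 := one_sub_norm_sq_pow_ne_zero hw (J + 2) (by simp)
  have h4 : (J : ℂ) + 2 ≠ 0 := by
    have : ((J + 2 : ℕ) : ℂ) ≠ 0 := Nat.cast_ne_zero.2 (by simp)
    simpa using this
  have h5 : w ^ J / (1 - ((‖w‖ ^ 2 : ℝ) : ℂ) ^ (J + 2)) ≠ 0 := div_ne_zero (pow_ne_zero _ hw0) h3
  have h6 := mul_left_cancel₀ h4 (mul_right_cancel₀ h5 h)
  rw [div_eq_div_iff h1 h2] at h6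
  rw [ofReal_norm_sq, mul_pow] at h3
  have h7 : (μ - μ') * (1 - w ^ (J + 2) * (starRingEnd ℂ) w ^ (J + 2)) = 0 := by
    linear_combination h6
  exact sub_eq_zero.1 ((mul_eq_zero.1 h7).resolve_right h3)

/-- The factor `c² c ^ J = c ^ n` is absorbed into the numerator through `c̄ ^ n = c ^ (-n)`. -/
theorem hopfQ_mul (J : ℕ) {c : ℂ} (hc : ‖c‖ = 1) (z : ℂ) :
    c ^ 2 * hopfQ J 1 (c * z) = hopfQ J (c ^ (J + 2)) z := by
  have hcc : c ^ (J + 2) * (starRingEnd ℂ c) ^ (J + 2) = 1 := by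
    rw [← mul_pow, Complex.mul_conj, Complex.normSq_eq_norm_sq, hc]
    simp
  rw [hopfQ, hopfQ, norm_mul, hc, one_mul, map_mul, mul_pow, mul_pow, mul_pow, one_mul]
  rw [show c ^ (J + 2) - (starRingEnd ℂ z) ^ (J + 2)
    = c ^ (J + 2) * (1 - (starRingEnd ℂ c) ^ (J + 2) * (starRingEnd ℂ z) ^ (J + 2)) by
      linear_combination (starRingEnd ℂ z) ^ (J + 2) * hcc]
  ring

/-- The derivative of the Möbius map has its determinant `1 - s ^ n` as numerator, which cancels the
radial denominator; what remains is holomorphic in `z`. -/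
theorem hasDerivAt_hopfQ (J : ℕ) {μ : ℝ → ℂ} {μ' : ℂ} {τ : ℝ} (hμ : HasDerivAt μ μ' τ)
    (hμ1 : ‖μ τ‖ = 1) {z : ℂ} (hz : ‖z‖ < 1) :
    HasDerivAt (fun t => hopfQ J (μ t) z)
      (z ^ J * (((J : ℂ) + 2) * μ' / (1 - μ τ * z ^ (J + 2)) ^ 2)) τ := by
  have h1 := one_sub_mul_pow_ne_zero hμ1 hz (J + 2) (by simp)
  have h3 := one_sub_norm_sq_pow_ne_zero hz (J + 2) (by simp)
  have h := (((hμ.sub_const ((starRingEnd ℂ z) ^ (J + 2))).div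
    ((hμ.mul_const (z ^ (J + 2))).const_sub 1) h1).const_mul ((J : ℂ) + 2)).mul_const
    (z ^ J / (1 - ((‖z‖ ^ 2 : ℝ) : ℂ) ^ (J + 2)))
  refine h.congr_deriv ?_
  rw [ofReal_norm_sq, mul_pow] at h3 ⊢
  field_simp
  ring

/-- The Herglotz kernel `n (1 + μ z ^ n) / (1 - μ z ^ n)`, `n = J + 2`. -/
def herglotz (J : ℕ) (μ z : ℂ) : ℂ :=
  ((J : ℂ) + 2) * ((1 + μ * z ^ (J + 2)) / (1 - μ * z ^ (J + 2)))

theorem hasDerivAt_herglotz (J : ℕ) {μ z : ℂ} (hμ : ‖μ‖ = 1) (hz : ‖z‖ < 1) :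
    HasDerivAt (herglotz J μ)
      (2 * (z ^ (J + 1) * (((J : ℂ) + 2) ^ 2 * μ / (1 - μ * z ^ (J + 2)) ^ 2))) z := by
  have h1 := one_sub_mul_pow_ne_zero hμ hz (J + 2) (by simp)
  have hp : HasDerivAt (fun z : ℂ => μ * z ^ (J + 2)) (μ * (((J : ℂ) + 2) * z ^ (J + 1))) z := by
    simpa using ((hasDerivAt_id z).pow (J + 2)).const_mul μ
  refine (((hp.const_add 1).div (hp.const_sub 1) h1).const_mul ((J : ℂ) + 2)).congr_deriv ?_
  field_simp
  ring

/-- This is `n` times the Poisson kernel `(1 - |μ z ^ n|²) / |1 - μ z ^ n|²`, hence harmonic and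
without zeros. -/
theorem herglotz_re (J : ℕ) {μ z : ℂ} (hμ : ‖μ‖ = 1) (hz : ‖z‖ < 1) :
    ((herglotz J μ z).re : ℂ) = ((J : ℂ) + 2) * (1 - ((‖z‖ ^ 2 : ℝ) : ℂ) ^ (J + 2)) /
      ((1 - μ * z ^ (J + 2)) * (1 - starRingEnd ℂ μ * (starRingEnd ℂ z) ^ (J + 2))) := by
  have h1 := one_sub_mul_pow_ne_zero hμ hz (J + 2) (by simp)
  have h2 := one_sub_mul_pow_ne_zero (μ := starRingEnd ℂ μ) (w := starRingEnd ℂ z)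
    (by rwa [Complex.norm_conj]) (by rwa [Complex.norm_conj]) (J + 2) (by simp)
  have hμμ : μ * starRingEnd ℂ μ = 1 := by
    rw [Complex.mul_conj, Complex.normSq_eq_norm_sq, hμ]; simp
  rw [Complex.re_eq_add_conj, herglotz]
  simp only [map_mul, map_div₀, map_add, map_sub, map_one, map_pow, map_ofNat, map_natCast]
  rw [ofReal_norm_sq, mul_pow]
  field_simp
  linear_combination (-2 * ((J : ℂ) + 2) * (starRingEnd ℂ z) ^ (J + 2) * z ^ (J + 2)) * hμμ

/-- Since `μ - z̄ ^ n = μ (1 - μ̄ z̄ ^ n)`, the argument of `Q` varies with `τ` at the rate given by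
this real part. The factor `i n μ` is `dμ/dτ` for `μ = exp (i n τ)`. -/
theorem hopfQ_eq_div_herglotz (J : ℕ) {μ z : ℂ} (hμ : ‖μ‖ = 1) (hz : ‖z‖ < 1) :
    (herglotz J μ z).re ≠ 0 ∧ hopfQ J μ z = -Complex.I * z ^ J *
      (((J : ℂ) + 2) * (Complex.I * ((J : ℂ) + 2) * μ) / (1 - μ * z ^ (J + 2)) ^ 2 /
        ((herglotz J μ z).re : ℂ)) := by
  have h1 := one_sub_mul_pow_ne_zero hμ hz (J + 2) (by simp)
  have h2 := one_sub_mul_pow_ne_zero (μ := starRingEnd ℂ μ) (w := starRingEnd ℂ z)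
    (by rwa [Complex.norm_conj]) (by rwa [Complex.norm_conj]) (J + 2) (by simp)
  have h3 := one_sub_norm_sq_pow_ne_zero hz (J + 2) (by simp)
  have h4 : (J : ℂ) + 2 ≠ 0 := by
    have : ((J + 2 : ℕ) : ℂ) ≠ 0 := Nat.cast_ne_zero.2 (by simp)
    simpa using this
  have hμμ : μ * starRingEnd ℂ μ = 1 := by
    rw [Complex.mul_conj, Complex.normSq_eq_norm_sq, hμ]; simp
  have hre := herglotz_re J hμ hz
  refine ⟨fun h => ?_, ?_⟩
  · rw [h, Complex.ofReal_zero] at hre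
    exact div_ne_zero (mul_ne_zero h4 h3) (mul_ne_zero h1 h2) hre.symm
  · rw [hre, hopfQ]
    field_simp
    rw [Complex.I_sq]
    linear_combination ((starRingEnd ℂ z) ^ (J + 2) * z ^ J) * hμμ

/-- `Re F = (F + F̄) / 2`, and `∂/∂z` annihilates the antiholomorphic half. -/
theorem dz_ofReal_re {F : ℂ → ℂ} {F' z : ℂ} (hF : HasDerivAt F F' z) :
    dz (fun w => ((F w).re : ℂ)) z = F' / 2 := by
  have h : HasFDerivAt (fun w => ((F w).re : ℂ)) _ z :=
    Complex.ofRealCLM.hasFDerivAt.comp z (Complex.reCLM.hasFDerivAt.comp z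
      (hF.hasFDerivAt.restrictScalars ℝ))
  rw [dz, dx, dy, h.fderiv]
  apply Complex.ext <;> simp

end BonnetFamily

/-! ### The Bonnet family and the index -/

section Rotation

variable {J : ℕ} {r : ℝ} {f : ℂ → E3} {h m : ℝ → ℝ}

theorem norm_exp_mul_I_pow (τ : ℝ) (n : ℕ) : ‖Complex.exp (τ * Complex.I) ^ n‖ = 1 := by
  rw [norm_pow, Complex.norm_exp_ofReal_mul_I, one_pow]

theorem hasDerivAt_exp_mul_I_pow (J : ℕ) (τ : ℝ) :
    HasDerivAt (fun t : ℝ => Complex.exp (t * Complex.I) ^ (J + 2))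
      (Complex.I * ((J : ℂ) + 2) * Complex.exp (τ * Complex.I) ^ (J + 2)) τ := by
  have h0 : HasDerivAt (fun t : ℝ => (t : ℂ) * Complex.I) Complex.I τ := by
    simpa using (Complex.ofRealCLM.hasDerivAt (x := τ)).mul_const Complex.I
  refine (h0.cexp.pow (J + 2)).congr_deriv ?_
  push_cast
  ring

theorem exp_mul_I_pow_injOn (J : ℕ) :
    InjOn (fun t : ℝ => Complex.exp (t * Complex.I) ^ (J + 2))
      (Ioo (-(1 / ((J : ℝ) + 2))) (1 / ((J : ℝ) + 2))) := by
  have hJ : (0 : ℝ) < (J : ℝ) + 2 := by positivity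
  have hb : ∀ t ∈ Ioo (-(1 / ((J : ℝ) + 2))) (1 / ((J : ℝ) + 2)),
      -1 < ((J : ℝ) + 2) * t ∧ ((J : ℝ) + 2) * t < 1 := by
    rintro t ⟨h1, h2⟩
    rw [lt_div_iff₀ hJ] at h2
    rw [← neg_div, div_lt_iff₀ hJ] at h1
    constructor <;> linarith
  -- The bound `|(J + 2) t| < 1 < π` keeps the arguments in one period of the exponential.
  intro t ht t' ht' h
  have hpi := Real.pi_gt_three
  have e : ∀ s : ℝ, Complex.exp (s * Complex.I) ^ (J + 2)
      = Complex.exp (((((J : ℝ) + 2) * s : ℝ) : ℂ) * Complex.I) := fun s => by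
    rw [← Complex.exp_nat_mul]; congr 1; push_cast; ring
  simp only [e] at h
  obtain ⟨h1, h2⟩ := hb t ht
  obtain ⟨h3, h4⟩ := hb t' ht'
  have := Complex.exp_inj_of_neg_pi_lt_of_le_pi (x := ((((J : ℝ) + 2) * t : ℝ) : ℂ) * Complex.I)
    (y := ((((J : ℝ) + 2) * t' : ℝ) : ℂ) * Complex.I)
    (by simpa using by linarith) (by simpa using by linarith) (by simpa using by linarith)
    (by simpa using by linarith) h
  have h5 := Complex.ofReal_injective (mul_right_cancel₀ Complex.I_ne_zero this)
  exact mul_left_cancel₀ hJ.ne' h5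

/-- The rotations of a surface whose metric and mean curvature are radial, and whose Hopf
differential is the canonical one. -/
def rotation (f : ℂ → E3) (τ : ℝ) (z : ℂ) : E3 := f (Complex.exp (τ * Complex.I) * z)

theorem exp_mul_I_mul_mem_ball (τ : ℝ) {z : ℂ} (hz : z ∈ Metric.ball (0 : ℂ) r) :
    Complex.exp (τ * Complex.I) * z ∈ Metric.ball (0 : ℂ) r := by
  rw [mem_ball_zero_iff] at hz ⊢
  rwa [norm_mul, Complex.norm_exp_ofReal_mul_I, one_mul]

theorem rotation_zero (f : ℂ → E3) : rotation f 0 = f := by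
  funext z
  simp [rotation]

theorem hopf_rotation (hf : AnalyticOnNhd ℝ f (Metric.ball 0 r))
    (hconf : IsConformalImmersion (Metric.ball 0 r) f)
    (hQ : ∀ z ∈ Metric.ball (0 : ℂ) r, hopf f z = hopfQ J 1 z)
    (τ : ℝ) {z : ℂ} (hz : z ∈ Metric.ball (0 : ℂ) r) :
    hopf (rotation f τ) z = hopfQ J (Complex.exp (τ * Complex.I) ^ (J + 2)) z := by
  have hcz := exp_mul_I_mul_mem_ball τ hz
  obtain ⟨-, h0, h1, h2⟩ := hconf _ hcz
  have hc := Complex.norm_exp_ofReal_mul_I τ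
  refine (curvature_comp_mul hc (hf _ hcz) h0 h1 h2).2.trans ?_
  rw [hQ _ hcz, hopfQ_mul J hc]

theorem isBonnetFamily_rotation (hr : 0 < r) (hr1 : r ≤ 1)
    (hf : AnalyticOnNhd ℝ f (Metric.ball 0 r))
    (hconf : IsConformalImmersion (Metric.ball 0 r) f)
    (hm : ∀ z ∈ Metric.ball (0 : ℂ) r, metricCoeff f z = m (‖z‖ ^ 2))
    (hH : ∀ z ∈ Metric.ball (0 : ℂ) r, meanCurvature f z = h (‖z‖ ^ 2))
    (hQ : ∀ z ∈ Metric.ball (0 : ℂ) r, hopf f z = hopfQ J 1 z)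
    (hh : StrictAntiOn h (Ioo 0 (r ^ 2))) :
    IsBonnetFamily (Metric.ball 0 r) (1 / ((J : ℝ) + 2)) (rotation f) := by
  have hc := Complex.norm_exp_ofReal_mul_I
  have hnorm : ∀ (τ : ℝ) (z : ℂ), ‖Complex.exp (τ * Complex.I) * z‖ = ‖z‖ := fun τ z => by
    rw [norm_mul, hc, one_mul]
  have hrot : ∀ (τ : ℝ), ∀ z ∈ Metric.ball (0 : ℂ) r,
      (dx (rotation f τ) z ≠ 0 ∧ ‖dx (rotation f τ) z‖ = ‖dy (rotation f τ) z‖ ∧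
        inner ℝ (dx (rotation f τ) z) (dy (rotation f τ) z) = 0) ∧
      metricCoeff (rotation f τ) z = m (‖z‖ ^ 2) ∧
      meanCurvature (rotation f τ) z = h (‖z‖ ^ 2) := fun τ z hz => by
    have hcz := exp_mul_I_mul_mem_ball τ hz
    obtain ⟨-, h0, h1, h2⟩ := hconf _ hcz
    obtain ⟨e1, e2, e3, e4⟩ := conformal_comp_mul (hc τ) (hf _ hcz).differentiableAt h0 h1 h2
    exact ⟨⟨e1, e2, e3⟩, e4.trans ((hm _ hcz).trans (by rw [hnorm])),
      (curvature_comp_mul (hc τ) (hf _ hcz) h0 h1 h2).1.trans ((hH _ hcz).trans (by rw [hnorm]))⟩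
  have hanalytic : ∀ τ : ℝ, AnalyticOnNhd ℝ (rotation f τ) (Metric.ball 0 r) := fun τ z hz =>
    (hf _ (exp_mul_I_mul_mem_ball τ hz)).comp
      (g := f) (f := fun z => Complex.exp (τ * Complex.I) * z) (by fun_prop)
  have hmem : ∀ s ∈ Ioo 0 (r ^ 2), ∃ w : ℂ, w ∈ Metric.ball (0 : ℂ) r ∧ w ≠ 0 ∧ ‖w‖ ^ 2 = s := by
    rintro s ⟨hs0, hs⟩
    have hsq := Real.sq_sqrt hs0.le
    have hn : ‖(Real.sqrt s : ℂ)‖ = Real.sqrt s := by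
      rw [Complex.norm_real, Real.norm_of_nonneg (Real.sqrt_nonneg s)]
    refine ⟨Real.sqrt s, ?_, ?_, by rw [hn, hsq]⟩
    · rw [mem_ball_zero_iff, hn]
      exact (Real.sqrt_lt' hr).2 hs
    · exact Complex.ofReal_ne_zero.2 (Real.sqrt_pos.2 hs0).ne'
  have hr2 : 0 < r ^ 2 := by positivity
  have hlt : h (r ^ 2 / 2) < h (r ^ 2 / 3) :=
    hh ⟨by positivity, by linarith⟩ ⟨by positivity, by linarith⟩ (by linarith)
  refine ⟨Metric.isOpen_ball, (convex_ball _ _).isConnected (Metric.nonempty_ball.2 hr),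
    by positivity, ?_, ?_, ?_, ?_, ?_, ?_⟩
  · have h1 : ContDiffOn ℝ ∞ f (Metric.ball 0 r) := fun z hz =>
      (hf z hz).contDiffAt.contDiffWithinAt
    refine h1.comp (f := fun p : ℝ × ℂ => Complex.exp (p.1 * Complex.I) * p.2) ?_
      fun p hp => exp_mul_I_mul_mem_ball p.1 hp.2
    refine ContDiff.contDiffOn (ContDiff.mul (ContDiff.cexp (ContDiff.mul ?_ contDiff_const))
      contDiff_snd)
    exact Complex.ofRealCLM.contDiff.comp contDiff_fst
  · exact fun τ _ z hz => ⟨(hanalytic τ z hz).differentiableAt, (hrot τ z hz).1⟩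
  · exact fun τ _ z hz => by rw [(hrot τ z hz).2.1, (hrot 0 z hz).2.1]
  · exact fun τ _ z hz => by rw [(hrot τ z hz).2.2, (hrot 0 z hz).2.2]
  · obtain ⟨w, hw, -, hws⟩ := hmem (r ^ 2 / 2) ⟨by positivity, by linarith⟩
    obtain ⟨w', hw', -, hws'⟩ := hmem (r ^ 2 / 3) ⟨by positivity, by linarith⟩
    refine ⟨w, hw, w', hw', ?_⟩
    rw [(hrot 0 w hw).2.2, (hrot 0 w' hw').2.2, hws, hws']
    exact hlt.ne
  · rintro τ hτ τ' hτ' hne ⟨g, hg⟩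
    -- The sign in `curvature_of_isometry` is fixed only where `H ≠ 0`. Strict monotonicity gives
    -- different values of `h` at `r² / 2` and `r² / 3`, so one of them is nonzero.
    obtain ⟨s, hs, hs0⟩ : ∃ s ∈ Ioo 0 (r ^ 2), h s ≠ 0 := by
      by_cases h0 : h (r ^ 2 / 2) = 0
      · exact ⟨r ^ 2 / 3, ⟨by positivity, by linarith⟩, by rw [h0] at hlt; exact hlt.ne'⟩
      · exact ⟨r ^ 2 / 2, ⟨by positivity, by linarith⟩, h0⟩
    obtain ⟨w, hw, hw0, hws⟩ := hmem s hs
    obtain ⟨h0, h1, h2⟩ := (hrot τ w hw).1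
    obtain ⟨ε, -, e1, e2⟩ :=
      curvature_of_isometry Metric.isOpen_ball g hg (hanalytic τ) hw h0 h1 h2
    rw [(hrot τ w hw).2.2, (hrot τ' w hw).2.2, hws] at e1
    have hε : ε = 1 := mul_right_cancel₀ hs0 (by rw [← e1, one_mul])
    rw [hε, Complex.ofReal_one, one_mul, hopf_rotation hf hconf hQ τ hw,
      hopf_rotation hf hconf hQ τ' hw] at e2
    exact hne (exp_mul_I_pow_injOn J hτ hτ' (hopfQ_injective J (norm_exp_mul_I_pow _ _)
      (norm_exp_mul_I_pow _ _) hw0 ((mem_ball_zero_iff.1 hw).trans_le hr1) e2.symm))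

theorem hasCriticalPointOfIndex_of_hopf (hr : 0 < r) (hr1 : r ≤ 1)
    (hf : AnalyticOnNhd ℝ f (Metric.ball 0 r))
    (hconf : IsConformalImmersion (Metric.ball 0 r) f)
    (hQ : ∀ z ∈ Metric.ball (0 : ℂ) r, hopf f z = hopfQ J 1 z)
    (hcrit : (0 : ℂ) ∈ criticalSet (Metric.ball 0 r) f)
    (hfam : IsBonnetFamily (Metric.ball 0 r) (1 / ((J : ℝ) + 2)) (rotation f)) :
    HasCriticalPointOfIndex (Metric.ball 0 r) f 0 (-(J : ℤ)) := by
  have hJ : (J : ℂ) + 2 ≠ 0 := by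
    have : ((J + 2 : ℕ) : ℂ) ≠ 0 := Nat.cast_ne_zero.2 (by simp)
    simpa using this
  set μ : ℝ → ℂ := fun τ => Complex.exp (τ * Complex.I) ^ (J + 2) with hμdef
  have hμ : ∀ τ, ‖μ τ‖ = 1 := fun τ => norm_exp_mul_I_pow τ _
  have hμ0 : ∀ τ, μ τ ≠ 0 := fun τ => norm_ne_zero_iff.1 (by rw [hμ]; exact one_ne_zero)
  have hlt : ∀ z ∈ Metric.ball (0 : ℂ) r, ‖z‖ < 1 := fun z hz =>
    (mem_ball_zero_iff.1 hz).trans_le hr1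
  have hden : ∀ τ, ∀ z ∈ Metric.ball (0 : ℂ) r, 1 - μ τ * z ^ (J + 2) ≠ 0 := fun τ z hz =>
    one_sub_mul_pow_ne_zero (hμ τ) (hlt z hz) (J + 2) (by simp)
  have hdiff : ∀ (τ : ℝ) (a : ℂ),
      DifferentiableOn ℂ (fun z => a / (1 - μ τ * z ^ (J + 2)) ^ 2) (Metric.ball 0 r) :=
    fun τ a => DifferentiableOn.div (by fun_prop) (by fun_prop)
      fun z hz => pow_ne_zero _ (hden τ z hz)
  -- Witnesses: `φ` is `∂Q/∂τ` divided by `z ^ J`, `ψ` is the real part of the Herglotz kernel, and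
  -- `θ` is half the derivative of that kernel divided by `z ^ (J + 1)`.
  refine ⟨hcrit, _, rotation f, hfam, fun z _ => by rw [rotation_zero], J, rfl, Metric.ball 0 r,
    Metric.isOpen_ball, Metric.mem_ball_self hr, Subset.rfl,
    fun τ z => ((J : ℂ) + 2) * (Complex.I * ((J : ℂ) + 2) * μ τ) / (1 - μ τ * z ^ (J + 2)) ^ 2,
    fun τ z => ((J : ℂ) + 2) ^ 2 * μ τ / (1 - μ τ * z ^ (J + 2)) ^ 2,
    fun τ z => (herglotz J (μ τ) z).re, fun τ _ => ⟨hdiff τ _, hdiff τ _, ?_, ?_, ?_⟩⟩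
  · have hd : DifferentiableOn ℂ (herglotz J (μ τ)) (Metric.ball 0 r) := fun z hz =>
      (hasDerivAt_herglotz J (hμ τ) (hlt z hz)).differentiableAt.differentiableWithinAt
    exact fun z hz => (hd.analyticAt (Metric.isOpen_ball.mem_nhds hz)).harmonicAt_re
  · simp [hJ, hμ0 τ]
  · intro z hz
    obtain ⟨hre, hq⟩ := hopfQ_eq_div_herglotz J (hμ τ) (hlt z hz)
    refine ⟨?_, hre, ?_, ?_, ?_⟩
    · exact div_ne_zero (mul_ne_zero hJ (mul_ne_zero (mul_ne_zero Complex.I_ne_zero hJ) (hμ0 τ)))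
        (pow_ne_zero _ (hden τ z hz))
    · rw [sub_zero]
      refine (hasDerivAt_hopfQ J (hasDerivAt_exp_mul_I_pow J τ) (hμ τ)
        (hlt z hz)).congr_of_eventuallyEq (Eventually.of_forall fun t => ?_)
      exact hopf_rotation hf hconf hQ t hz
    · rw [sub_zero, hopf_rotation hf hconf hQ τ hz]
      exact hq
    · rw [sub_zero, dz_ofReal_re (hasDerivAt_herglotz J (hμ τ) (hlt z hz)),
        mul_div_cancel_left₀ _ two_ne_zero]

end Rotation

/-! ### Critical points and the Hazzidakis equation for `h` -/

section Profile

/-- The radial mean curvature function has no critical points away from the origin. -/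
theorem isIsolatedCriticalPoint_of_radial {J : ℕ} {r : ℝ} {f : ℂ → E3} {h p : ℝ → ℝ} (hr : 0 < r)
    (hH : ∀ z ∈ Metric.ball (0 : ℂ) r, meanCurvature f z = h (‖z‖ ^ 2))
    (hd : ∀ z ∈ Metric.ball (0 : ℂ) r, HasDerivAt h ((‖z‖ ^ 2) ^ J * p (‖z‖ ^ 2)) (‖z‖ ^ 2))
    (hp : ∀ x, p x ≠ 0) :
    IsIsolatedCriticalPoint (Metric.ball 0 r) f 0 := by
  have hfd : ∀ z ∈ Metric.ball (0 : ℂ) r, fderiv ℝ (meanCurvature f) z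
      = ((‖z‖ ^ 2) ^ J * p (‖z‖ ^ 2)) • (2 • innerSL ℝ z) := fun z hz => by
    have he : meanCurvature f =ᶠ[𝓝 z] fun w => h (‖w‖ ^ 2) :=
      eventually_of_mem (Metric.isOpen_ball.mem_nhds hz) hH
    rw [he.fderiv_eq, (hasFDerivAt_radial (hd z hz)).fderiv]
  refine ⟨⟨Metric.mem_ball_self hr, ?_⟩, ?_⟩
  · rw [hfd 0 (Metric.mem_ball_self hr)]
    simp
  · refine eventually_of_mem self_mem_nhdsWithin fun z hz hcrit => ?_
    have hz0 : z ≠ 0 := hz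
    have hn : ‖z‖ ≠ 0 := norm_ne_zero_iff.2 hz0
    -- The gradient is radial, so testing it in the direction `z` loses nothing.
    have h1 := congrArg (fun L : ℂ →L[ℝ] ℝ => L z) ((hfd z hcrit.1).symm.trans hcrit.2)
    have h2 : (‖z‖ ^ 2) ^ J * p (‖z‖ ^ 2) * (2 * ‖z‖ ^ 2) = 0 := by
      simpa [-mul_eq_zero, -Complex.inner, real_inner_self_eq_norm_sq] using h1
    exact mul_ne_zero (mul_ne_zero (pow_ne_zero _ (pow_ne_zero _ hn)) (hp _))
      (mul_ne_zero two_ne_zero (pow_ne_zero _ hn)) h2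

/-- Taking the logarithmic derivative of `h' = x ^ J G₀ exp g` gives `x h'' / h' = J + x g'`, and
the constant `J` disappears on differentiating. -/
theorem hazzidakis_of_hasDerivAt {J : ℕ} {h g : ℝ → ℝ} {G₀ s k : ℝ} (hG₀ : G₀ ≠ 0)
    (hs : 0 < s)
    (hd : ∀ᶠ x in 𝓝 s, HasDerivAt h (x ^ J * (G₀ * Real.exp (g x))) x)
    (hg : ∀ᶠ x in 𝓝 s, DifferentiableAt ℝ g x)
    (hode : HasDerivAt (fun x => x * deriv g x)
      (s ^ J * (G₀ * Real.exp (g s)) + k *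
        (2 * s ^ (J + 1) - h s ^ 2 / (G₀ * Real.exp (g s)))) s) :
    deriv (fun x => x * deriv (deriv h) x / deriv h x) s - deriv h s
      = k * s ^ (J + 1) * (2 - h s ^ 2 / (s * deriv h s)) := by
  have hpos : ∀ᶠ x in 𝓝 s, 0 < x := lt_mem_nhds hs
  have hd' : deriv h =ᶠ[𝓝 s] fun x => x ^ J * (G₀ * Real.exp (g x)) := hd.mono fun x hx => hx.deriv
  have hlog : (fun x => x * deriv (deriv h) x / deriv h x) =ᶠ[𝓝 s]
      fun x => (J : ℝ) + x * deriv g x := by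
    filter_upwards [hd'.eventuallyEq_nhds, hd', hg, hpos] with x h1 h2 h3 h4
    have h5 : HasDerivAt (fun x => x ^ J * (G₀ * Real.exp (g x)))
        ((J : ℝ) * x ^ (J - 1) * (G₀ * Real.exp (g x))
          + x ^ J * (G₀ * (Real.exp (g x) * deriv g x))) x :=
      (hasDerivAt_pow J x).mul (h3.hasDerivAt.exp.const_mul G₀)
    have h6 : (J : ℝ) * x ^ (J - 1) * x = J * x ^ J := by
      rcases J with _ | n
      · simp
      · rw [Nat.add_sub_cancel]; ring
    have hE := (Real.exp_pos (g x)).ne'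
    have hx : x ^ J ≠ 0 := (pow_pos h4 J).ne'
    rw [h1.deriv_eq, h5.deriv, h2, div_eq_iff (mul_ne_zero hx (mul_ne_zero hG₀ hE))]
    linear_combination (G₀ * Real.exp (g x)) * h6
  rw [hlog.deriv_eq, (hode.const_add (J : ℝ)).deriv, hd'.self_of_nhds]
  have hE := (Real.exp_pos (g s)).ne'
  have hsJ : s ^ J ≠ 0 := (pow_pos hs J).ne'
  field_simp
  ring

end Profile

end BonnetSurface

end

/-! ### The theorem -/

open BonnetSurface Set Filter
theorem mainTheorem11 (J : ℕ) (Hinit H₀ : ℝ) (hH₀ : H₀ < 0) :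
    ∃ (r : ℝ) (f : ℂ → BonnetSurface.E3) (h B : ℝ → ℝ),
      AnalyticOnNhd ℝ f (Metric.ball 0 r) ∧
      BonnetSurface.IsTypeBV (Metric.ball 0 r) f ∧
      BonnetSurface.IsIsolatedCriticalPoint (Metric.ball 0 r) f 0 ∧
      BonnetSurface.HasCriticalPointOfIndex (Metric.ball 0 r) f 0 (-(J : ℤ)) ∧
      BonnetSurface.IsNormalCoordinate J r f h B ∧
      h 0 = Hinit ∧ B 0 = H₀ ∧
      BonnetSurface.meanCurvature f 0 = Hinit ∧
      BonnetSurface.metricCoeff f 0 = -2 * ((J : ℝ) + 2) ^ 2 / (((J : ℝ) + 1) * H₀) := by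
  have hJ : (0 : ℝ) < (J : ℝ) + 1 := by positivity
  have hG₀ : ((J : ℝ) + 1) * H₀ < 0 := mul_neg_of_pos_of_neg hJ hH₀
  obtain ⟨B, g, f, hB, hg, hf, hg0, hB0, hode, hsurf⟩ := exists_surface J Hinit _ hG₀
  -- Integrating `h' = s ^ J G` gives `B 0 = G₀ / (J + 1)`, which this choice turns into `H₀`.
  set G₀ := ((J : ℝ) + 1) * H₀ with hG₀def
  have hB0' : B 0 = H₀ := by rw [hB0, hG₀def, mul_div_cancel_left₀ _ hJ.ne']
  obtain ⟨h, hh⟩ : ∃ h : ℝ → ℝ, h = fun s => Hinit + s ^ (J + 1) * B s := ⟨_, rfl⟩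
  have hhx : ∀ x, h x = Hinit + x ^ (J + 1) * B x := fun x => by rw [hh]
  have hBne : ∀ᶠ x in 𝓝 (0 : ℝ), B x ≠ 0 :=
    hB.continuousAt.eventually_ne (by rw [hB0']; exact hH₀.ne)
  have hreal := (hB.eventually_analyticAt.and (hg.eventually_analyticAt.and hBne)).and hode
  obtain ⟨ρ, hρ, hρball⟩ := Metric.eventually_nhds_iff.1 hreal
  obtain ⟨σ, hσ, hσball⟩ := Metric.eventually_nhds_iff.1 (hf.eventually_analyticAt.and hsurf)
  obtain ⟨r, hr, hr1, hrρ, hrσ⟩ : ∃ r : ℝ, 0 < r ∧ r ≤ 1 ∧ r ≤ ρ ∧ r ≤ σ :=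
    ⟨min 1 (min ρ σ), by positivity, min_le_left _ _, (min_le_right _ _).trans (min_le_left _ _),
      (min_le_right _ _).trans (min_le_right _ _)⟩
  -- The profile is needed at `s = |z|² < r²`; because `r ≤ 1`, this lies within the radius `ρ`.
  have hr2 : r ^ 2 ≤ r := by nlinarith
  have hR : ∀ s ∈ Ico 0 (r ^ 2), dist s 0 < ρ := fun s hs => by
    rw [Real.dist_eq, sub_zero, abs_of_nonneg hs.1]
    linarith [hs.2]
  have hC : ∀ z ∈ Metric.ball (0 : ℂ) r, dist z 0 < σ := fun z hz =>
    (Metric.mem_ball.1 hz).trans_le hrσ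
  have hsq : ∀ z ∈ Metric.ball (0 : ℂ) r, ‖z‖ ^ 2 ∈ Ico 0 (r ^ 2) := fun z hz =>
    ⟨by positivity, pow_lt_pow_left₀ (mem_ball_zero_iff.1 hz) (norm_nonneg z) two_ne_zero⟩
  have hderiv : ∀ s ∈ Ico 0 (r ^ 2), HasDerivAt h (s ^ J * (G₀ * Real.exp (g s))) s :=
    fun s hs => by rw [hh]; exact (hρball (hR s hs)).2.1
  have hfan : AnalyticOnNhd ℝ f (Metric.ball 0 r) := fun z hz => (hσball (hC z hz)).1
  have hconf : IsConformalImmersion (Metric.ball 0 r) f := fun z hz =>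
    ⟨(hfan z hz).differentiableAt, (hσball (hC z hz)).2.1⟩
  have hmetric := fun z hz => (hσball (hC z hz)).2.2.1
  have hH : ∀ z ∈ Metric.ball (0 : ℂ) r, meanCurvature f z = h (‖z‖ ^ 2) := fun z hz => by
    rw [hhx]; exact (hσball (hC z hz)).2.2.2.1
  have hQ : ∀ z ∈ Metric.ball (0 : ℂ) r, hopf f z = hopfQ J 1 z := fun z hz =>
    (hσball (hC z hz)).2.2.2.2
  have hanti : StrictAntiOn h (Ioo 0 (r ^ 2)) := by
    refine strictAntiOn_of_deriv_neg (convex_Ioo _ _)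
      (fun s hs => (hderiv s ⟨hs.1.le, hs.2⟩).continuousAt.continuousWithinAt) fun s hs => ?_
    rw [interior_Ioo] at hs
    rw [(hderiv s ⟨hs.1.le, hs.2⟩).deriv]
    exact mul_neg_of_pos_of_neg (pow_pos hs.1 J) (mul_neg_of_neg_of_pos hG₀ (Real.exp_pos _))
  have hiso : IsIsolatedCriticalPoint (Metric.ball 0 r) f 0 :=
    isIsolatedCriticalPoint_of_radial (p := fun x => G₀ * Real.exp (g x)) hr hH
      (fun z hz => hderiv _ (hsq z hz)) fun x => mul_ne_zero hG₀.ne (Real.exp_pos _).ne'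
  have hfam : IsBonnetFamily (Metric.ball 0 r) (1 / ((J : ℝ) + 2)) (rotation f) :=
    isBonnetFamily_rotation
      (m := fun s => 2 * ((J : ℝ) + 2) ^ 2 / ((1 - s ^ (J + 2)) ^ 2 * -(G₀ * Real.exp (g s))))
      hr hr1 hfan hconf hmetric hH hQ hanti
  have h0 : h 0 = Hinit := by rw [hhx]; simp
  have hball0 : (0 : ℂ) ∈ Metric.ball (0 : ℂ) r := Metric.mem_ball_self hr
  refine ⟨r, f, h, B, hfan, ⟨⟨_, rotation f, hfam, fun z _ => by rw [rotation_zero]⟩, 0, hiso⟩,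
    hiso, hasCriticalPointOfIndex_of_hopf hr hr1 hfan hconf hQ hiso.1 hfam, ?_, h0, hB0', ?_, ?_⟩
  · refine ⟨hr, hr1, fun s hs => (hρball (hR s hs)).1.1, fun s hs => (hρball (hR s hs)).1.2.2,
      fun s => by rw [h0, hhx], fun s hs => ?_, hH, fun z hz => ?_, fun z hz hz0 => ?_⟩
    · have hnear : ∀ᶠ x in 𝓝 s, x ∈ Ioo 0 (r ^ 2) := isOpen_Ioo.mem_nhds hs
      have hs' : s ∈ Ico 0 (r ^ 2) := ⟨hs.1.le, hs.2⟩
      refine (hazzidakis_of_hasDerivAt (k := ((J : ℝ) + 2) ^ 2 / (1 - s ^ (J + 2)) ^ 2) hG₀.ne hs.1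
        (hnear.mono fun x hx => hderiv x ⟨hx.1.le, hx.2⟩)
        ((hρball (hR s hs')).1.2.1.eventually_analyticAt.mono fun x hx => hx.differentiableAt)
        (by rw [hhx]; exact (hρball (hR s hs')).2.2)).trans ?_
      rw [div_mul_eq_mul_div]
    · rw [hQ z hz, hopfQ, one_mul]
    · rw [hmetric z hz, (hderiv _ (hsq z hz)).deriv]
      have hz1 : (‖z‖ ^ 2) ^ J ≠ 0 := pow_ne_zero _ (pow_ne_zero _ (norm_ne_zero_iff.2 hz0))
      have hE := (Real.exp_pos (g (‖z‖ ^ 2))).ne'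
      have hG := hG₀.ne
      have h1 : 1 - (‖z‖ ^ 2) ^ (J + 2) ≠ 0 := by
        have := one_sub_norm_sq_pow_ne_zero ((mem_ball_zero_iff.1 hz).trans_le hr1) (J + 2)
          (by simp)
        exact_mod_cast this
      generalize ‖z‖ ^ 2 = s at *
      field_simp
  · rw [hH 0 hball0, norm_zero, zero_pow two_ne_zero, h0]
  · rw [hmetric 0 hball0, norm_zero, zero_pow two_ne_zero, hg0]
    simp [hG₀def, neg_div, div_neg]
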